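/- **Setting.** Let $m,n\ge 1$, $L>0$, and let $n$ agents hold $m$ samples each. The loss $\ell_{ij}:\mathbb R^d\to\mathbb R$ of the $j$-th sample of agent $i$ is differentiable with $\|\nabla \ell_{ij}(x)-\nabla \ell_{ij}(y)\|_2\le L\|x-y\|_2$ for all $x,y$. Put $f_i=\frac1m\sum_{j}\ell_{ij}$ and $f=\frac1n\sum_i f_i$, and assume $f^*=\inf f>-\infty$. For a stacked vector $x=[x_1,\dots,x_n]$ let $\nabla F(x)=[\nabla f_1(x_1),\dots,\nabla f_n(x_n)]$. The agents communicate over an undirected graph. $W\in\mathbb R^{n\times n}$ is a mixing matrix: $w_{ij}=0$ if $i\ne j$ are not adjacent, and all row and column sums equal $1$. Its mixing rate is $\alpha=\|W-\frac1n\mathbf 1\mathbf 1^\top\|_{\rm op}$, and we assume $\alpha<1$. **Chebyshev-accelerated mixing.** Let $V=\frac12(W+W^\top)$, which is $W$ itself when $W$ is symmetric. $K$ accelerated mixing steps multiply a stacked vector by $(P_K(V)\otimes I_d)$, where $P_K(V)=T_K(V/\alpha)/T_K(1/\alpha)$ and $T_K$ is the Chebyshev polynomial of the first kind ($P_K(V)=V^K$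 if $\alpha=0$). By the three-term recurrence this takes $K$ rounds of communication. **Algorithm (DESTRESS).** Input: a starting point $\bar x^{(0)}\in\mathbb R^d$, $\eta$, $T$, $S$, $b$, $K_{\rm in}$, $K_{\rm out}$. Initialize $x_i^{(0)}=u_i^{(0),S}=\bar x^{(0)}$ and $s_i^{(0)}=\nabla f(\bar x^{(0)})$ for all $i$. For $t=1,\dots,T$: set $x^{(t)}=u^{(t-1),S}$, $s^{(t)}=(P_{K_{\rm out}}(V)\otimes I_d)\big(s^{(t-1)}+\nabla F(x^{(t)})-\nabla F(x^{(t-1)})\big)$, $u^{(t),0}=x^{(t)}$, $v^{(t),0}=s^{(t)}$. Then for $s=1,\dots,S$: each agent $i$ draws a mini-batch of $b$ of its own samples, independently and uniformly at random (with replacement), with indices $j_1,\dots,j_b$, and $$u^{(t),s}=(P_{K_{\rm in}}(V)\otimes I_d)(u^{(t),s-1}-\eta v^{(t),s-1}),$$ $$g_i^{(t),s}=\tfrac1b\sum_{k=1}^b\big(\nabla\ell_{ij_k}(u_i^{(t),s})-\nabla\ell_{ij_k}(u_i^{(t),s-1})\big)+v_i^{(t),s-1},\qquad v^{(t),s}=(P_{K_{\rm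 in}}(V)\otimes I_d)\,g^{(t),s}.$$ The output $x^{\rm output}$ is $u_i^{(t),s-1}$ with $(i,t,s)$ uniform in $[n]\times[T]\times[S]$, independent of the mini-batches. **Claim.** Set $$S=\lceil\sqrt{mn}\rceil,\quad b=\lceil\sqrt{m/n}\rceil,\quad K_{\rm out}=\Big\lceil\frac{\log(\sqrt{nb}+1)}{\sqrt{1-\alpha}}\Big\rceil,\quad K_{\rm in}=\Big\lceil\frac{\log 2}{\sqrt{1-\alpha}}\Big\rceil,\quad \eta=\frac1{160L}.$$ There is a universal constant $C>0$ such that for all $m,n,L$ as above and all $\varepsilon>0$, $\Delta\ge0$ there is a number $T\ge1$ of outer loops (depending only on $m,n,L,\varepsilon,\Delta$) such that, for all $d$, graphs, mixing matrices, losses and starting points as above with $f(\bar x^{(0)})-f^*\le\Delta$, DESTRESS with these parameters reaches an $\varepsilon$-approximate first-order stationary point in expectation, $\mathbb E\|\nabla f(x^{\rm output})\|_2^2\le\varepsilon$, and uses * at most $C\max\{1,\sqrt{n/m}\}\Big(m+\sqrt{m/n}\,\dfrac{L\Delta}{\varepsilon}\Big)$ evaluations of sample gradients (IFO calls) per agent,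 initialization included; that is, $O\big(m+(m/n)^{1/2}L\Delta/\varepsilon\big)$ when $n\le m$; * at most $\dfrac{C}{\sqrt{1-\alpha}}\Big(\sqrt{mn}+\dfrac{L\Delta}{\varepsilon}\Big)$ rounds of communication in the mixing steps. -/

import Mathlib

open scoped BigOperators

noncomputable section

namespace Destress

/-! ### Finite-sum objective -/

/-- The parameter space `ℝ^d` with the Euclidean norm. -/
abbrev Param (d : ℕ) : Type := EuclideanSpace ℝ (Fin d)

/-- A stacked vector `x = [x_1, …, x_n]` in `ℝ^{nd}`: one copy of the parameter per agent. -/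
abbrev Stack (n d : ℕ) : Type := Fin n → Param d

/-- The sample losses: `ℓ i j` is the loss `ℓ(·; z)` of the `j`-th sample `z` of agent `i`. -/
abbrev Losses (n m d : ℕ) : Type := Fin n → Fin m → Param d → ℝ

/-- The local objective `f_i(x) = (1/m) ∑_j ℓ(x; z_{ij})`. -/
def localLoss {n m d : ℕ} (ℓ : Losses n m d) (i : Fin n) (x : Param d) : ℝ :=
  (1 / (m : ℝ)) * ∑ j, ℓ i j x

/-- The global objective `f(x) = (1/n) ∑_i f_i(x)`. -/
def globalLoss {n m d : ℕ} (ℓ : Losses n m d) (x : Param d) : ℝ :=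
  (1 / (n : ℝ)) * ∑ i, localLoss ℓ i x

/-- Every sample loss is differentiable with `L`-Lipschitz gradient. -/
def LipschitzGradients {n m d : ℕ} (ℓ : Losses n m d) (L : ℝ) : Prop :=
  ∀ i j, Differentiable ℝ (ℓ i j) ∧
    ∀ x y, ‖gradient (ℓ i j) x - gradient (ℓ i j) y‖ ≤ L * ‖x - y‖

/-! ### Mixing matrices -/

/-- `W` is a mixing matrix for the communication graph `G`: agents that are not neighbours do not
exchange information, and all row and column sums are one. -/
structure IsMixingMatrix {n : ℕ} (G : SimpleGraph (Fin n)) (W : Matrix (Fin n) (Fin n) ℝ) :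
    Prop where
  local_support : ∀ i j, i ≠ j → ¬ G.Adj i j → W i j = 0
  row_sum : ∀ i, ∑ j, W i j = 1
  col_sum : ∀ j, ∑ i, W i j = 1

/-- The mixing rate `α = ‖W - (1/n) 1 1ᵀ‖_op`. -/
def mixingRate {n : ℕ} (W : Matrix (Fin n) (Fin n) ℝ) : ℝ :=
  ‖Matrix.toEuclideanCLM (n := Fin n) (𝕜 := ℝ) (W - Matrix.of fun _ _ => 1 / (n : ℝ))‖

/-- The symmetric part `(W + Wᵀ)/2`, which is `W` itself if `W` is symmetric. For a mixing matrix
of an (undirected) graph it is again a mixing matrix of that graph, with mixing rate at most that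
of `W`. -/
def symPart {n : ℕ} (W : Matrix (Fin n) (Fin n) ℝ) : Matrix (Fin n) (Fin n) ℝ :=
  (1 / 2 : ℝ) • (W + W.transpose)

/-! ### Computations with a resource count -/

/-- The result of a distributed computation, with the number of incremental first-order oracle
calls (evaluations of one sample gradient `∇ℓ(x; z)` at one point) made by each agent and the
number of communication rounds. All agents make the same number of calls. -/
structure Run (β : Type) : Type where
  val : β
  ifo : ℕ
  rounds : ℕ

/-- Sequential composition adds the counts. -/
instance : Monad Run where
  pure a := ⟨a, 0, 0⟩
  bind a f := ⟨(f a.val).val, a.ifo + (f a.val).ifo, a.rounds + (f a.val).rounds⟩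

/-- One communication round: `y ↦ (V ⊗ I_d) y`, each agent combines the vectors of its
neighbours. -/
def gossip {n d : ℕ} (V : Matrix (Fin n) (Fin n) ℝ) (y : Stack n d) : Run (Stack n d) where
  val := fun i => ∑ j, V i j • y j
  ifo := 0
  rounds := 1

/-- Chebyshev three-term recurrence `z_0 = y`, `z_1 = V y`, `z_{k+2} = 2 V z_{k+1} - α² z_k`, that
is, `z_k = α^k T_k(V/α) y`. The value is the pair `(z_k, z_{k+1})`. -/
def chebIter {n d : ℕ} (V : Matrix (Fin n) (Fin n) ℝ) (α : ℝ) (y : Stack n d) :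
    ℕ → Run (Stack n d × Stack n d)
  | 0 => do
      let z ← gossip V y
      pure (y, z)
  | k + 1 => do
      let p ← chebIter V α y k
      let w ← gossip V p.2
      pure (p.2, (2 : ℝ) • w - (α ^ 2) • p.1)

/-- The same recurrence at the eigenvalue `1`, i.e. `α^k T_k(1/α)`. -/
def chebWeight (α : ℝ) : ℕ → ℝ
  | 0 => 1
  | 1 => 1
  | k + 2 => 2 * chebWeight α (k + 1) - α ^ 2 * chebWeight α k

/-- `K` Chebyshev-accelerated mixing steps: `y ↦ (T_K(V/α) / T_K(1/α)) y`, using `K` rounds of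
communication (for `α = 0` this is the limit `V^K`). -/
def chebMix {n d : ℕ} (V : Matrix (Fin n) (Fin n) ℝ) (α : ℝ) :
    ℕ → Stack n d → Run (Stack n d)
  | 0, y => pure y
  | k + 1, y => do
      let p ← chebIter V α y k
      pure ((chebWeight α (k + 1))⁻¹ • p.2)

/-- All agents evaluate their local gradients `∇f_i(x_i) = (1/m) ∑_j ∇ℓ(x_i; z_{ij})`. -/
def localGradients {n m d : ℕ} (ℓ : Losses n m d) (x : Stack n d) : Run (Stack n d) where
  val := fun i => (1 / (m : ℝ)) • ∑ j, gradient (ℓ i j) (x i)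
  ifo := m
  rounds := 0

/-- The mini-batches of all agents in one inner step: each agent draws `b` of its `m` samples,
independently. -/
abbrev Batch (n m b : ℕ) : Type := Fin n → Fin b → Fin m

/-- All agents evaluate `(1/b) ∑_{z ∈ Z_i} (∇ℓ(u'_i; z) - ∇ℓ(u_i; z))`. -/
def batchDifference {n m d b : ℕ} (ℓ : Losses n m d) (Z : Batch n m b) (u' u : Stack n d) :
    Run (Stack n d) where
  val := fun i =>
    (1 / (b : ℝ)) • ∑ k, (gradient (ℓ i (Z i k)) (u' i) - gradient (ℓ i (Z i k)) (u i))
  ifo := 2 * b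
  rounds := 0

/-! ### The algorithm -/

/-- Step size, number `S` of inner loops, batch size `b`, and numbers of mixing steps. -/
structure Config : Type where
  η : ℝ
  S : ℕ
  b : ℕ
  Kin : ℕ
  Kout : ℕ

/-- One inner step `(u^{s-1}, v^{s-1}) ↦ (u^s, v^s)`. -/
def innerStep {n m d : ℕ} (ℓ : Losses n m d) (W : Matrix (Fin n) (Fin n) ℝ) (c : Config)
    (Z : Batch n m c.b) (p : Stack n d × Stack n d) : Run (Stack n d × Stack n d) := do
  let u ← chebMix (symPart W) (mixingRate W) c.Kin (p.1 - c.η • p.2)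
  let δ ← batchDifference ℓ Z u p.1
  let v ← chebMix (symPart W) (mixingRate W) c.Kin (δ + p.2)
  pure (u, v)

/-- The pair `(u^s, v^s)`, for `s ≤ S`, of the inner loop started at `p`. -/
def innerIter {n m d : ℕ} (ℓ : Losses n m d) (W : Matrix (Fin n) (Fin n) ℝ) (c : Config)
    (Z : Fin c.S → Batch n m c.b) (p : Stack n d × Stack n d) :
    (s : ℕ) → s ≤ c.S → Run (Stack n d × Stack n d)
  | 0, _ => pure p
  | s + 1, h => do
      let q ← innerIter ℓ W c Z p s (Nat.le_of_succ_le h)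
      innerStep ℓ W c (Z ⟨s, h⟩) q

/-- The quantities `x^{(t)}`, `s^{(t)}` and `u^{(t),S}` after the outer loop `t`. -/
structure OuterState (n d : ℕ) : Type where
  x : Stack n d
  s : Stack n d
  uS : Stack n d

/-- Initialization: `x_i^{(0)}` is the common starting point `x₀`, `s_i^{(0)} = ∇f(x₀)`, and
`u^{(0),S} = x^{(0)}`, as there is no inner loop for `t = 0`. -/
def initial {n m d : ℕ} (ℓ : Losses n m d) (x₀ : Param d) : Run (OuterState n d) := do
  let g ← localGradients ℓ (fun _ => x₀)
  pure { x := fun _ => x₀, s := fun _ => (1 / (n : ℝ)) • ∑ i, g i, uS := fun _ => x₀ }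

/-- The beginning of an outer loop: new parameter estimate `x^{(t)} = u^{(t-1),S}` and gradient
tracking `s^{(t)} = W_out (s^{(t-1)} + ∇F(x^{(t)}) - ∇F(x^{(t-1)}))`. The value is the starting
point `(u^{(t),0}, v^{(t),0}) = (x^{(t)}, s^{(t)})` of the inner loop. -/
def track {n m d : ℕ} (ℓ : Losses n m d) (W : Matrix (Fin n) (Fin n) ℝ) (c : Config)
    (st : OuterState n d) : Run (Stack n d × Stack n d) := do
  let gNew ← localGradients ℓ st.uS
  let gOld ← localGradients ℓ st.x
  let s ← chebMix (symPart W) (mixingRate W) c.Kout (st.s + gNew - gOld)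
  pure (st.uS, s)

/-- All mini-batches drawn in `T` outer loops (the loops `t = 1, …, T` and `s = 1, …, S` are
indexed from `0`). -/
abbrev Samples (n m : ℕ) (c : Config) (T : ℕ) : Type := Fin T → Fin c.S → Batch n m c.b

/-- The state after `t ≤ T` outer loops. -/
def outerIter {n m d : ℕ} (ℓ : Losses n m d) (W : Matrix (Fin n) (Fin n) ℝ) (c : Config)
    (x₀ : Param d) {T : ℕ} (Z : Samples n m c T) : (t : ℕ) → t ≤ T → Run (OuterState n d)
  | 0, _ => initial ℓ x₀
  | t + 1, h => do
      let st ← outerIter ℓ W c x₀ Z t (Nat.le_of_succ_le h)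
      let p ← track ℓ W c st
      let q ← innerIter ℓ W c (Z ⟨t, h⟩) p c.S le_rfl
      pure { x := p.1, s := p.2, uS := q.1 }

/-- The stacked inner iterate `u^{(t+1),s}`, for `t < T` and `s < S`. -/
def iterate {n m d : ℕ} (ℓ : Losses n m d) (W : Matrix (Fin n) (Fin n) ℝ) (c : Config)
    (x₀ : Param d) {T : ℕ} (Z : Samples n m c T) (t : Fin T) (s : Fin c.S) : Stack n d :=
  let p := track ℓ W c (outerIter ℓ W c x₀ Z t t.isLt.le).val
  (innerIter ℓ W c (Z t) p.val s s.isLt.le).val.1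

/-- All random choices of the algorithm: the mini-batches, and the index `(t, s, i)` of the iterate
that is returned. They are uniformly distributed on this finite type. -/
abbrev Outcome (n m : ℕ) (c : Config) (T : ℕ) : Type :=
  Samples n m c T × (Fin T × Fin c.S × Fin n)

/-- DESTRESS with `T` outer loops: the value is the output point, the counts are those of the
initialization and the whole of the `T` outer loops. -/
def destress {n m d : ℕ} (ℓ : Losses n m d) (W : Matrix (Fin n) (Fin n) ℝ) (c : Config)
    (x₀ : Param d) (T : ℕ) (ω : Outcome n m c T) : Run (Param d) where
  val := iterate ℓ W c x₀ ω.1 ω.2.1 ω.2.2.1 ω.2.2.2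
  ifo := (outerIter ℓ W c x₀ ω.1 T le_rfl).ifo
  rounds := (outerIter ℓ W c x₀ ω.1 T le_rfl).rounds

/-- The parameter choices `S = ⌈√(mn)⌉`, `b = ⌈√(m/n)⌉`, `K_out = ⌈log(√(nb)+1)/√(1-α)⌉`,
`K_in = ⌈log 2/√(1-α)⌉` and `η = 1/(160 L)`. -/
def chosenConfig (n m : ℕ) (L α : ℝ) : Config where
  η := 1 / (160 * L)
  S := ⌈√((m : ℝ) * n)⌉₊
  b := ⌈√((m : ℝ) / n)⌉₊
  Kin := ⌈Real.log 2 / √(1 - α)⌉₊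
  Kout := ⌈Real.log (√((n : ℝ) * (⌈√((m : ℝ) / n)⌉₊ : ℝ)) + 1) / √(1 - α)⌉₊

end Destress

end

/-!
Convergence and complexity of DESTRESS. The average iterate performs inexact gradient descent
(`descent_step`): up to telescoping terms, the squared gradients are bounded by the consensus
errors plus the squared error of the average gradient estimate `v̄`, minus `79/80` of `‖v̄‖²`. That negative
term pays for everything else, since `η L = 1/160`.

* *Mixing.* On the complement of the consensus space the symmetric part `V` of the mixing matrix has
  norm at most `α`, so that in an eigenbasis `P_K(V)` has norm at most `1 / T_K(1/α)`
  (`frob_dev_chebMix_le`). With `1/α = cosh y` one has `y ≥ √2 √(1-α)`, because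
  `cosh x ≤ exp (x²/2)`. Hence the inner mixing contracts by `2/3`, and the outer mixing by `2/3`
  and by `2/√(nb)` (`pow_div_chebWeight_le`).
* *Consensus.* For every choice of the mini-batches, the consensus errors of the iterates and of the
  gradient estimates satisfy a linear recursion driven by the steps `η v̄` of the average. An outer
  loop sees the sum of the `S` steps of the inner loop, which costs a factor `S` in mean square; the
  factor `2/√(nb)` of the outer mixing makes up for it, as `S ≤ nb`. The initial state is in
  consensus, so the total error is bounded by the steps alone (`consensus_recursion`,
  `sum_consensusAt_le`).
* *Variance.* Gradient tracking makes `v̄` exact at the beginning of each inner loop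
  (`errAt_zero`). Afterwards its error is a sum of martingale differences, each an average of `nb`
  independent centred terms of size `L` times the increment of the iterates (`expect_batch_le`,
  `expect_errAt_succ_le`). Over the `S ≤ nb` steps of a loop, the errors sum to at most `L²` times
  the squared increments (`sum_expect_errAt_le`).

Together these give a mean squared gradient of at most `4 Δ / (η T S) = 640 L Δ / (T S)`
(`expect_norm_gradient_destress_le`), so that `T` of order `1 + L Δ / (ε S)` loops suffice; the
resource bounds then follow by counting (`outerIter_counts`).
-/

noncomputable section

namespace Destress

/-! ### Chebyshev polynomials on a symmetric operator -/

/-- The value `α^k T_k(x/α)` of the rescaled Chebyshev polynomial, defined by its recurrence so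
that `α = 0` needs no special treatment. -/
def chebValue (α x : ℝ) : ℕ → ℝ
  | 0 => 1
  | 1 => x
  | k + 2 => 2 * x * chebValue α x (k + 1) - α ^ 2 * chebValue α x k

lemma abs_chebValue_le {α x : ℝ} (hx : |x| ≤ α) (k : ℕ) : |chebValue α x k| ≤ α ^ k := by
  have hα : 0 ≤ α := (abs_nonneg x).trans hx
  rcases hα.eq_or_lt with rfl | hα
  · have hx0 : x = 0 := by simpa using hx
    subst hx0
    match k with
    | 0 => simp [chebValue]
    | 1 => simp [chebValue]
    | k + 2 => simp [chebValue]
  · obtain ⟨θ, rfl⟩ : ∃ θ, x = α * Real.cos θ := by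
      refine ⟨Real.arccos (x / α), ?_⟩
      rw [Real.cos_arccos]
      · field_simp
      · rw [le_div_iff₀ hα]; linarith [(abs_le.1 hx).1]
      · rw [div_le_iff₀ hα]; linarith [(abs_le.1 hx).2]
    have key : ∀ k : ℕ, chebValue α (α * Real.cos θ) k = α ^ k * Real.cos (k * θ) := by
      intro k
      induction k using Nat.twoStepInduction with
      | zero => simp [chebValue]
      | one => simp [chebValue]
      | more k h0 h1 =>
        have e1 : ((k + 2 : ℕ) : ℝ) * θ = ((k + 1 : ℕ) : ℝ) * θ + θ := by push_cast; ring
        have e0 : (k : ℝ) * θ = ((k + 1 : ℕ) : ℝ) * θ - θ := by push_cast; ring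
        rw [chebValue, h0, h1, e1, e0, Real.cos_add, Real.cos_sub]
        ring
    rw [key, abs_mul, abs_of_pos (pow_pos hα k)]
    exact mul_le_of_le_one_right (pow_pos hα k).le (Real.abs_cos_le_one _)

/-- A symmetric operator bounded by `α` satisfies `‖α^k T_k(A/α) z‖ ≤ α^k ‖z‖`: in an eigenbasis
of `A` the recurrence decouples into scalar ones. -/
lemma norm_cheb_recurrence_le {E : Type*} [NormedAddCommGroup E] [InnerProductSpace ℝ E]
    [FiniteDimensional ℝ E] {A : E →ₗ[ℝ] E} (hA : A.IsSymmetric) {α : ℝ}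
    (hα : 0 ≤ α) (hb : ∀ z, ‖A z‖ ≤ α * ‖z‖) {z : ℕ → E} (h1 : z 1 = A (z 0))
    (h2 : ∀ k, z (k + 2) = (2 : ℝ) • A (z (k + 1)) - α ^ 2 • z k) (k : ℕ) :
    ‖z k‖ ≤ α ^ k * ‖z 0‖ := by
  set b := hA.eigenvectorBasis rfl with hbdef
  have hlam : ∀ i, |hA.eigenvalues rfl i| ≤ α := by
    intro i
    have h := hb (b i)
    rw [hbdef, hA.apply_eigenvectorBasis rfl i, norm_smul, ← hbdef, b.norm_eq_one] at h
    simpa using h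
  have hco : ∀ k i, b.repr (z k) i = chebValue α (hA.eigenvalues rfl i) k * b.repr (z 0) i := by
    intro k i
    induction k using Nat.twoStepInduction with
    | zero => simp [chebValue]
    | one => rw [h1, hbdef, hA.eigenvectorBasis_apply_self_apply rfl]; rfl
    | more k e0 e1 =>
      rw [h2, map_sub, map_smul, map_smul, PiLp.sub_apply, PiLp.smul_apply, PiLp.smul_apply, e0,
        hbdef, hA.eigenvectorBasis_apply_self_apply rfl, ← hbdef, e1, chebValue]
      simp only [smul_eq_mul, RCLike.ofReal_real_eq_id, id]
      ring
  refine le_of_sq_le_sq ?_ (by positivity)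
  rw [mul_pow, ← b.repr.norm_map (z k), ← b.repr.norm_map (z 0), EuclideanSpace.norm_sq_eq,
    EuclideanSpace.norm_sq_eq, Finset.mul_sum]
  refine Finset.sum_le_sum fun i _ => ?_
  rw [hco, norm_mul, mul_pow]
  refine mul_le_mul_of_nonneg_right ?_ (by positivity)
  exact pow_le_pow_left₀ (norm_nonneg _) (abs_chebValue_le (hlam i) k) 2

lemma chebWeight_pos_and_le {α : ℝ} (h0 : 0 ≤ α) (h1 : α ≤ 1) (k : ℕ) :
    0 < chebWeight α k ∧ chebWeight α k ≤ chebWeight α (k + 1) := by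
  induction k with
  | zero => simp [chebWeight]
  | succ k ih =>
    have hα : α ^ 2 ≤ 1 := pow_le_one₀ h0 h1
    refine ⟨ih.1.trans_le ih.2, ?_⟩
    rw [show k + 1 + 1 = k + 2 from rfl, chebWeight]
    nlinarith [mul_le_mul_of_nonneg_right hα ih.1.le]

lemma chebWeight_pos {α : ℝ} (h0 : 0 ≤ α) (h1 : α ≤ 1) (k : ℕ) : 0 < chebWeight α k :=
  (chebWeight_pos_and_le h0 h1 k).1

lemma chebWeight_eq_cosh {α y : ℝ} (hα : α * Real.cosh y = 1) (k : ℕ) :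
    chebWeight α k = α ^ k * Real.cosh (k * y) := by
  induction k using Nat.twoStepInduction with
  | zero => simp [chebWeight]
  | one => simpa [chebWeight] using hα.symm
  | more k h0 h1 =>
    have e1 : ((k + 2 : ℕ) : ℝ) * y = ((k + 1 : ℕ) : ℝ) * y + y := by push_cast; ring
    have e0 : (k : ℝ) * y = ((k + 1 : ℕ) : ℝ) * y - y := by push_cast; ring
    have e2 : (2 : ℝ) * (α ^ (k + 1) * Real.cosh (((k + 1 : ℕ) : ℝ) * y)) =
        2 * (α ^ (k + 1) * Real.cosh (((k + 1 : ℕ) : ℝ) * y)) * (α * Real.cosh y) := by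
      rw [hα, mul_one]
    rw [chebWeight, h0, h1, e1, e0, Real.cosh_add, Real.cosh_sub, e2]
    ring

/-- `arcosh (1/α) ≥ √2 √(1-α)`, the source of the accelerated rate. -/
lemma sqrt_two_mul_sqrt_le {α y : ℝ} (h1 : α < 1) (hy : 0 ≤ y) (hα : α * Real.cosh y = 1) :
    √2 * √(1 - α) ≤ y := by
  have hα0 : 0 < α := by
    have := Real.cosh_pos y
    by_contra h
    nlinarith [mul_nonpos_of_nonpos_of_nonneg (not_lt.1 h) this.le]
  have hx : 0 ≤ √2 * √(1 - α) := by positivity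
  have hsq : (√2 * √(1 - α)) ^ 2 / 2 = 1 - α := by
    rw [mul_pow, Real.sq_sqrt (by norm_num), Real.sq_sqrt (by linarith)]; ring
  have h2 : Real.cosh (√2 * √(1 - α)) ≤ Real.cosh y := by
    refine (Real.cosh_le_exp_half_sq _).trans ?_
    rw [hsq]
    have h3 : α ≤ Real.exp (-(1 - α)) := by linarith [Real.add_one_le_exp (-(1 - α))]
    rw [Real.exp_neg] at h3
    have hc : Real.cosh y = α⁻¹ := eq_inv_of_mul_eq_one_right hα
    rw [hc]
    exact (le_inv_comm₀ hα0 (Real.exp_pos _)).1 h3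
  have h4 := Real.cosh_le_cosh.1 h2
  rwa [abs_of_nonneg hx, abs_of_nonneg hy] at h4

/-- With `√2 log 2` the argument reached by `K_in` steps, this is the inner contraction `2/3`. -/
lemma three_halves_le_cosh {x : ℝ} (hx : √2 * Real.log 2 ≤ x) : 3 / 2 ≤ Real.cosh x := by
  have h0 : 0 ≤ √2 * Real.log 2 := mul_nonneg (Real.sqrt_nonneg _) (Real.log_nonneg (by norm_num))
  have h1 : Real.cosh (√2 * Real.log 2) ≤ Real.cosh x := by
    rw [Real.cosh_le_cosh, abs_of_nonneg h0, abs_of_nonneg (h0.trans hx)]; exact hx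
  refine le_trans ?_ h1
  set z := √2 * Real.log 2 / 2 with hz
  have hz2 : z ^ 2 = Real.log 2 ^ 2 / 2 := by
    rw [hz, div_pow, mul_pow, Real.sq_sqrt (by norm_num)]; ring
  -- `cosh (2z) = 2 cosh² z - 1` with `z² = (log 2)²/2 ≈ 0.2402`: the quadratic bound for `cosh` is
  -- too weak at `2z` itself, but suffices after halving the argument.
  have hl := Real.log_two_gt_d9
  have hzl : 6 / 25 ≤ z ^ 2 := by rw [hz2]; nlinarith
  have e : √2 * Real.log 2 = 2 * z := by rw [hz]; ring
  have hc : 1 + z ^ 2 / 2 ≤ Real.cosh z := by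
    have hs : z / 2 ≤ Real.sinh (z / 2) := Real.self_le_sinh_iff.2 (by positivity)
    have e2 : z = 2 * (z / 2) := by ring
    rw [e2, Real.cosh_two_mul, Real.cosh_sq, ← e2]
    nlinarith [mul_self_le_mul_self (by positivity : 0 ≤ z / 2) hs]
  rw [e, Real.cosh_two_mul, Real.sinh_sq]
  nlinarith

/-- After `K ≥ log q / √(1-α)` accelerated steps the consensus error has shrunk by
`1 / T_K(1/α)`, which is at most `2/3` and at most `2/q`. -/
lemma pow_div_chebWeight_le {α q : ℝ} (h0 : 0 ≤ α) (h1 : α < 1) (hq : 2 ≤ q) {k : ℕ}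
    (hk : Real.log q / √(1 - α) ≤ k) :
    α ^ k / chebWeight α k ≤ 2 / 3 ∧ α ^ k / chebWeight α k * q ≤ 2 := by
  have hs : 0 < √(1 - α) := Real.sqrt_pos.2 (by linarith)
  have hlog : Real.log 2 ≤ Real.log q := Real.log_le_log (by norm_num) hq
  have hlog2 : 0 < Real.log 2 := Real.log_pos (by norm_num)
  have hk0 : (0 : ℝ) < k := (div_pos (hlog2.trans_le hlog) hs).trans_le hk
  have hk1 : k ≠ 0 := by rintro rfl; simp at hk0
  rcases h0.eq_or_lt with rfl | hα
  · rw [zero_pow hk1]; norm_num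
  set y := Real.arcosh (1 / α) with hy
  have hge : 1 ≤ 1 / α := by rw [le_div_iff₀ hα]; linarith
  have hcy : α * Real.cosh y = 1 := by rw [hy, Real.cosh_arcosh hge]; field_simp
  have hy0 : 0 ≤ y := Real.arcosh_nonneg hge
  have hy1 := sqrt_two_mul_sqrt_le h1 hy0 hcy
  have hky : √2 * Real.log q ≤ k * y := by
    rw [div_le_iff₀ hs] at hk
    calc √2 * Real.log q ≤ √2 * (k * √(1 - α)) := by gcongr
      _ = k * (√2 * √(1 - α)) := by ring
      _ ≤ k * y := by gcongr
  have hc1 : 3 / 2 ≤ Real.cosh (k * y) := three_halves_le_cosh (le_trans (by gcongr) hky)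
  have hc2 : q / 2 ≤ Real.cosh (k * y) := by
    have hs2 : 1 ≤ √2 := Real.one_le_sqrt.2 (by norm_num)
    have h3 : q ≤ Real.exp (k * y) := by
      rw [← Real.exp_log (by linarith : 0 < q)]
      refine Real.exp_le_exp.2 (le_trans ?_ hky)
      nlinarith
    rw [Real.cosh_eq]
    linarith [Real.exp_pos (-(k * y))]
  have hdiv : α ^ k / chebWeight α k = 1 / Real.cosh (k * y) := by
    rw [chebWeight_eq_cosh hcy]
    have := pow_pos hα k
    have := Real.cosh_pos (k * y)
    field_simp
  have hcp := Real.cosh_pos (k * y)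
  rw [hdiv]
  constructor
  · rw [div_le_iff₀ hcp]; linarith
  · rw [div_mul_eq_mul_div, div_le_iff₀ hcp]; linarith

/-! ### Average, consensus error and norm of a stacked vector -/

/-- The average `x̄ = (1/n) ∑_i x_i` over the agents. -/
def mean {n d : ℕ} : Stack n d →ₗ[ℝ] Param d :=
  (1 / (n : ℝ)) • ∑ i, LinearMap.proj i

/-- The consensus error `(x_i - x̄)_i`. -/
def dev {n d : ℕ} : Stack n d →ₗ[ℝ] Stack n d :=
  LinearMap.id - LinearMap.pi fun _ => mean

/-- The norm `(∑_i ‖x_i‖²)^{1/2}` of a stacked vector; the norm of the function type `Stack n d`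
is the maximum norm. -/
def frob {n d : ℕ} (x : Stack n d) : ℝ := ‖WithLp.toLp 2 x‖

variable {n d : ℕ}

lemma mean_apply (x : Stack n d) : mean x = (1 / (n : ℝ)) • ∑ i, x i := by
  simp [mean]

lemma dev_apply (x : Stack n d) (i : Fin n) : dev x i = x i - mean x := by
  simp [dev]

lemma frob_nonneg (x : Stack n d) : 0 ≤ frob x := norm_nonneg _

lemma frob_sq (x : Stack n d) : frob x ^ 2 = ∑ i, ‖x i‖ ^ 2 :=
  PiLp.norm_sq_eq_of_L2 _ _

lemma frob_add_le (x y : Stack n d) : frob (x + y) ≤ frob x + frob y :=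
  norm_add_le (WithLp.toLp 2 x) (WithLp.toLp 2 y)

lemma frob_sub_le (x y : Stack n d) : frob (x - y) ≤ frob x + frob y :=
  norm_sub_le (WithLp.toLp 2 x) (WithLp.toLp 2 y)

lemma frob_smul (r : ℝ) (x : Stack n d) : frob (r • x) = |r| * frob x :=
  norm_smul r (WithLp.toLp 2 x)

lemma frob_zero : frob (0 : Stack n d) = 0 := norm_zero

lemma frob_le_of_forall {x y : Stack n d} {c : ℝ} (hc : 0 ≤ c) (h : ∀ i, ‖x i‖ ≤ c * ‖y i‖) :
    frob x ≤ c * frob y := by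
  refine le_of_sq_le_sq ?_ (mul_nonneg hc (frob_nonneg y))
  rw [mul_pow, frob_sq, frob_sq, Finset.mul_sum]
  refine Finset.sum_le_sum fun i _ => ?_
  rw [← mul_pow]
  exact pow_le_pow_left₀ (norm_nonneg _) (h i) 2

lemma sum_eq_smul_mean (hn : 0 < n) (x : Stack n d) : ∑ i, x i = (n : ℝ) • mean x := by
  have : (n : ℝ) ≠ 0 := by positivity
  rw [mean_apply, smul_smul, mul_one_div_cancel this, one_smul]

lemma sum_dev (hn : 0 < n) (x : Stack n d) : ∑ i, dev x i = 0 := by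
  simp_rw [dev_apply]
  rw [Finset.sum_sub_distrib, sum_eq_smul_mean hn]
  simp [Nat.cast_smul_eq_nsmul]

/-- Pythagoras: the average and the consensus error are orthogonal. -/
lemma frob_sq_eq (hn : 0 < n) (x : Stack n d) :
    frob x ^ 2 = n * ‖mean x‖ ^ 2 + frob (dev x) ^ 2 := by
  have h : ∀ i, ‖x i‖ ^ 2 = ‖mean x‖ ^ 2 + 2 * inner ℝ (mean x) (dev x i) + ‖dev x i‖ ^ 2 := by
    intro i
    rw [← norm_add_sq_real, dev_apply, add_sub_cancel]
  rw [frob_sq, frob_sq, Finset.sum_congr rfl fun i _ => h i, Finset.sum_add_distrib,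
    Finset.sum_add_distrib, ← Finset.mul_sum, ← inner_sum, sum_dev hn]
  simp

lemma frob_dev_le (hn : 0 < n) (x : Stack n d) : frob (dev x) ≤ frob x := by
  refine le_of_sq_le_sq ?_ (frob_nonneg x)
  rw [frob_sq_eq hn x]
  have : 0 ≤ (n : ℝ) * ‖mean x‖ ^ 2 := by positivity
  linarith

lemma norm_mean_sq_le (hn : 0 < n) (x : Stack n d) : n * ‖mean x‖ ^ 2 ≤ frob x ^ 2 := by
  rw [frob_sq_eq hn x]
  linarith [sq_nonneg (frob (dev x))]

lemma frob_le_add (hn : 0 < n) (x : Stack n d) :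
    frob x ≤ √n * ‖mean x‖ + frob (dev x) := by
  have h1 : 0 ≤ √(n : ℝ) * ‖mean x‖ := by positivity
  refine le_of_sq_le_sq ?_ (add_nonneg h1 (frob_nonneg _))
  rw [frob_sq_eq hn x, add_sq, mul_pow, Real.sq_sqrt (Nat.cast_nonneg n)]
  nlinarith [mul_nonneg h1 (frob_nonneg (dev x))]

/-! ### Contraction of the consensus error by accelerated mixing -/

lemma mean_gossip {V : Matrix (Fin n) (Fin n) ℝ} (hV : ∀ j, ∑ i, V i j = 1)
    (y : Stack n d) : mean (gossip V y).val = mean y := by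
  simp only [mean_apply, gossip]
  rw [Finset.sum_comm]
  simp_rw [← Finset.sum_smul, hV, one_smul]

/-- The operator `B ⊗ I_d` on stacked vectors. -/
def kronOp (B : Matrix (Fin n) (Fin n) ℝ) :
    PiLp 2 (fun _ : Fin n => Param d) →ₗ[ℝ] PiLp 2 (fun _ : Fin n => Param d) where
  toFun z := WithLp.toLp 2 fun i => ∑ j, B i j • z j
  map_add' z w := by
    ext1 i
    simp [smul_add, Finset.sum_add_distrib]
  map_smul' r z := by
    ext1 i
    simp [Finset.smul_sum, smul_comm r]

lemma kronOp_apply (B : Matrix (Fin n) (Fin n) ℝ) (z : PiLp 2 (fun _ : Fin n => Param d))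
    (i : Fin n) : kronOp B z i = ∑ j, B i j • z j := rfl

lemma kronOp_isSymmetric {B : Matrix (Fin n) (Fin n) ℝ} (hB : ∀ i j, B i j = B j i) :
    (kronOp (d := d) B).IsSymmetric := by
  intro z w
  rw [PiLp.inner_apply, PiLp.inner_apply]
  simp only [kronOp_apply, sum_inner, inner_sum, real_inner_smul_left, real_inner_smul_right]
  rw [Finset.sum_comm]
  refine Finset.sum_congr rfl fun i _ => Finset.sum_congr rfl fun j _ => ?_
  rw [hB]

lemma norm_kronOp_le (B : Matrix (Fin n) (Fin n) ℝ) (z : PiLp 2 (fun _ : Fin n => Param d)) :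
    ‖kronOp B z‖ ≤ ‖Matrix.toEuclideanCLM (n := Fin n) (𝕜 := ℝ) B‖ * ‖z‖ := by
  refine le_of_sq_le_sq ?_ (by positivity)
  have hcol : ∀ c : Fin d, ∑ i, (∑ j, B i j * z j c) ^ 2 ≤
      ‖Matrix.toEuclideanCLM (n := Fin n) (𝕜 := ℝ) B‖ ^ 2 * ∑ j, (z j c) ^ 2 := by
    intro c
    have h := (Matrix.toEuclideanCLM (n := Fin n) (𝕜 := ℝ) B).le_opNorm
      (WithLp.toLp 2 fun j => z j c)
    have h2 := pow_le_pow_left₀ (norm_nonneg _) h 2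
    rw [mul_pow, EuclideanSpace.norm_sq_eq, EuclideanSpace.norm_sq_eq] at h2
    simpa [Matrix.mulVec, dotProduct] using h2
  calc ‖kronOp B z‖ ^ 2 = ∑ i, ∑ c, (∑ j, B i j * z j c) ^ 2 := by
        rw [PiLp.norm_sq_eq_of_L2]
        refine Finset.sum_congr rfl fun i _ => ?_
        rw [EuclideanSpace.norm_sq_eq]
        refine Finset.sum_congr rfl fun c _ => ?_
        rw [Real.norm_eq_abs, sq_abs, kronOp_apply]
        simp
    _ = ∑ c, ∑ i, (∑ j, B i j * z j c) ^ 2 := Finset.sum_comm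
    _ ≤ ∑ c, ‖Matrix.toEuclideanCLM (n := Fin n) (𝕜 := ℝ) B‖ ^ 2 * ∑ j, (z j c) ^ 2 :=
        Finset.sum_le_sum fun c _ => hcol c
    _ = (‖Matrix.toEuclideanCLM (n := Fin n) (𝕜 := ℝ) B‖ * ‖z‖) ^ 2 := by
        rw [← Finset.mul_sum, Finset.sum_comm, mul_pow, PiLp.norm_sq_eq_of_L2]
        congr 1
        refine Finset.sum_congr rfl fun i _ => ?_
        rw [EuclideanSpace.norm_sq_eq]
        simp

lemma norm_symPart_sub_le (W : Matrix (Fin n) (Fin n) ℝ) :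
    ‖Matrix.toEuclideanCLM (n := Fin n) (𝕜 := ℝ)
      (symPart W - Matrix.of fun _ _ => 1 / (n : ℝ))‖ ≤ mixingRate W := by
  set M := W - Matrix.of fun _ _ : Fin n => 1 / (n : ℝ) with hM
  have h1 : symPart W - Matrix.of (fun _ _ : Fin n => 1 / (n : ℝ)) =
      (1 / 2 : ℝ) • (M + star M) := by
    ext i j
    simp [hM, symPart, Matrix.star_apply]
    ring
  have h2 : ‖Matrix.toEuclideanCLM (n := Fin n) (𝕜 := ℝ) M‖ = mixingRate W := rfl
  rw [h1, map_smul, map_add, map_star, norm_smul, ContinuousLinearMap.star_eq_adjoint]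
  have h3 := norm_add_le (Matrix.toEuclideanCLM (n := Fin n) (𝕜 := ℝ) M)
    (star (Matrix.toEuclideanCLM (n := Fin n) (𝕜 := ℝ) M))
  rw [ContinuousLinearMap.star_eq_adjoint, LinearIsometryEquiv.norm_map, h2] at h3
  rw [Real.norm_of_nonneg (by norm_num)]
  linarith

lemma mixingRate_nonneg (W : Matrix (Fin n) (Fin n) ℝ) : 0 ≤ mixingRate W := norm_nonneg _

lemma symPart_comm (W : Matrix (Fin n) (Fin n) ℝ) (i j : Fin n) :
    symPart W i j = symPart W j i := by
  simp [symPart, add_comm]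

lemma symPart_row_sum {G : SimpleGraph (Fin n)} {W : Matrix (Fin n) (Fin n) ℝ}
    (hW : IsMixingMatrix G W) (i : Fin n) : ∑ j, symPart W i j = 1 := by
  simp only [symPart, Matrix.smul_apply, Matrix.add_apply, Matrix.transpose_apply, smul_eq_mul]
  rw [← Finset.mul_sum, Finset.sum_add_distrib, hW.row_sum, hW.col_sum]
  norm_num

lemma symPart_col_sum {G : SimpleGraph (Fin n)} {W : Matrix (Fin n) (Fin n) ℝ}
    (hW : IsMixingMatrix G W) (j : Fin n) : ∑ i, symPart W i j = 1 := by
  simp_rw [symPart_comm W _ j]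
  exact symPart_row_sum hW j

lemma dev_gossip (hn : 0 < n) {V : Matrix (Fin n) (Fin n) ℝ} (hr : ∀ i, ∑ j, V i j = 1)
    (hc : ∀ j, ∑ i, V i j = 1) (y : Stack n d) (i : Fin n) :
    dev (gossip V y).val i =
      ∑ j, (V - Matrix.of fun _ _ : Fin n => 1 / (n : ℝ)) i j • dev y j := by
  rw [dev_apply, mean_gossip hc]
  simp only [Matrix.sub_apply, Matrix.of_apply, sub_smul]
  rw [Finset.sum_sub_distrib, ← Finset.smul_sum, sum_dev hn, smul_zero, sub_zero]
  simp only [dev_apply, smul_sub, gossip]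
  rw [Finset.sum_sub_distrib, ← Finset.sum_smul, hr, one_smul]

lemma chebIter_succ_succ (V : Matrix (Fin n) (Fin n) ℝ) (α : ℝ) (y : Stack n d) (k : ℕ) :
    (chebIter V α y (k + 2)).val.1 = (2 : ℝ) • (gossip V (chebIter V α y (k + 1)).val.1).val -
      α ^ 2 • (chebIter V α y k).val.1 := rfl

lemma chebIter_rounds (V : Matrix (Fin n) (Fin n) ℝ) (α : ℝ) (y : Stack n d) (k : ℕ) :
    (chebIter V α y k).rounds = k + 1 := by
  induction k with
  | zero => rfl
  | succ k ih => exact congrArg (· + 1) ih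

lemma chebIter_ifo (V : Matrix (Fin n) (Fin n) ℝ) (α : ℝ) (y : Stack n d) (k : ℕ) :
    (chebIter V α y k).ifo = 0 := by
  induction k with
  | zero => rfl
  | succ k ih => exact congrArg (· + 0) ih

lemma chebMix_rounds (V : Matrix (Fin n) (Fin n) ℝ) (α : ℝ) (K : ℕ) (y : Stack n d) :
    (chebMix V α K y).rounds = K := by
  cases K with
  | zero => rfl
  | succ k => exact chebIter_rounds V α y k

lemma chebMix_ifo (V : Matrix (Fin n) (Fin n) ℝ) (α : ℝ) (K : ℕ) (y : Stack n d) :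
    (chebMix V α K y).ifo = 0 := by
  cases K with
  | zero => rfl
  | succ k => exact chebIter_ifo V α y k

lemma chebMix_val (V : Matrix (Fin n) (Fin n) ℝ) (α : ℝ) (K : ℕ) (y : Stack n d) :
    (chebMix V α K y).val = (chebWeight α K)⁻¹ • (chebIter V α y K).val.1 := by
  cases K with
  | zero => simp [chebWeight, chebMix, chebIter, pure, bind]
  | succ k => rfl

lemma mean_chebIter {V : Matrix (Fin n) (Fin n) ℝ} (hc : ∀ j, ∑ i, V i j = 1)
    (α : ℝ) (y : Stack n d) (k : ℕ) :
    mean (chebIter V α y k).val.1 = chebWeight α k • mean y := by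
  induction k using Nat.twoStepInduction with
  | zero => simp [chebWeight, chebIter, pure, bind]
  | one =>
    rw [chebWeight, one_smul, ← mean_gossip hc y]
    rfl
  | more k h0 h1 =>
    rw [chebIter_succ_succ, map_sub, map_smul, map_smul, mean_gossip hc, h0, h1, chebWeight,
      smul_smul, smul_smul, ← sub_smul]

variable {G : SimpleGraph (Fin n)} {W : Matrix (Fin n) (Fin n) ℝ}

lemma mean_chebMix (hW : IsMixingMatrix G W) (hα : mixingRate W < 1) (K : ℕ)
    (y : Stack n d) : mean (chebMix (symPart W) (mixingRate W) K y).val = mean y := by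
  rw [chebMix_val, map_smul, mean_chebIter (symPart_col_sum hW), smul_smul,
    inv_mul_cancel₀ (chebWeight_pos (mixingRate_nonneg W) hα.le K).ne', one_smul]

/-- `K` accelerated mixing steps shrink the consensus error by the factor `1 / T_K(1/α)`. -/
lemma frob_dev_chebMix_le (hn : 0 < n) (hW : IsMixingMatrix G W) (hα : mixingRate W < 1) (K : ℕ)
    (y : Stack n d) :
    frob (dev (chebMix (symPart W) (mixingRate W) K y).val) ≤
      mixingRate W ^ K / chebWeight (mixingRate W) K * frob (dev y) := by
  set α := mixingRate W with hαdef
  have hα0 : 0 ≤ α := mixingRate_nonneg W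
  set B := symPart W - Matrix.of fun _ _ : Fin n => 1 / (n : ℝ) with hB
  have hdev : ∀ y : Stack n d, WithLp.toLp 2 (dev (gossip (symPart W) y).val) =
      kronOp B (WithLp.toLp 2 (dev y)) := by
    intro y
    ext1 i
    rw [kronOp_apply]
    exact dev_gossip hn (symPart_row_sum hW) (symPart_col_sum hW) y i
  have h := norm_cheb_recurrence_le (A := kronOp (d := d) B)
    (kronOp_isSymmetric fun i j => by simp [hB, symPart_comm W i j]) hα0
    (fun z => (norm_kronOp_le B z).trans
      (mul_le_mul_of_nonneg_right (norm_symPart_sub_le W) (norm_nonneg z)))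
    (z := fun k => WithLp.toLp 2 (dev (chebIter (symPart W) α y k).val.1))
    (hdev y)
    (fun k => by
      rw [chebIter_succ_succ, map_sub, map_smul, map_smul, ← hdev]
      rfl) K
  have hw := chebWeight_pos hα0 hα.le K
  rw [chebMix_val, map_smul, frob_smul, abs_of_pos (inv_pos.2 hw), div_eq_inv_mul, mul_assoc]
  exact mul_le_mul_of_nonneg_left h (inv_pos.2 hw).le

/-! ### Recursive inequalities for the consensus errors -/

lemma sum_le_of_recursion {Q P : ℕ → ℝ} {γ : ℝ} {T : ℕ} (hγ : 0 ≤ γ) (hQ : ∀ t, 0 ≤ Q t)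
    (hP : ∀ t, 0 ≤ P t) (h : ∀ t, t + 1 < T → Q (t + 1) ≤ γ * Q t + P t) :
    (1 - γ) * ∑ t ∈ Finset.range T, Q t ≤ Q 0 + ∑ t ∈ Finset.range T, P t := by
  cases T with
  | zero => simpa using hQ 0
  | succ T =>
    have h1 : ∑ t ∈ Finset.range T, Q (t + 1) ≤ ∑ t ∈ Finset.range T, (γ * Q t + P t) :=
      Finset.sum_le_sum fun t ht => h t (by simpa using ht)
    rw [Finset.sum_add_distrib, ← Finset.mul_sum] at h1
    have h2 : ∑ t ∈ Finset.range T, P t ≤ ∑ t ∈ Finset.range (T + 1), P t := by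
      rw [Finset.sum_range_succ]; linarith [hP T]
    have h3 : ∑ t ∈ Finset.range T, Q t ≤ ∑ t ∈ Finset.range (T + 1), Q t := by
      rw [Finset.sum_range_succ]; linarith [hQ T]
    have h4 := mul_le_mul_of_nonneg_left h3 hγ
    have h5 := Finset.sum_range_succ' Q T
    linarith

/-- Within an inner loop the quantity `y = a + 5 c`, with `a` and `c` the consensus errors of the
iterates and of the scaled gradient estimates, contracts up to the steps `w` of the average. -/
lemma inner_recursion {a c w : ℕ → ℝ} {S : ℕ} (hS : 0 < S)
    (ha : ∀ s, 0 ≤ a s) (hc : ∀ s, 0 ≤ c s)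
    (h1 : ∀ s < S, a (s + 1) ≤ 2 / 3 * (a s + c s))
    (h2 : ∀ s < S, c (s + 1) ≤ 2 / 3 * (c s + (w s + a (s + 1) + a s) / 160)) :
    (∃ R, a S ≤ 5 / 6 * (a 0 + 5 * c 0) + R ∧
      R ^ 2 ≤ (∑ s ∈ Finset.range S, w s ^ 2) / 384) ∧
    ∑ s ∈ Finset.range S, (a s + 5 * c s) ^ 2 ≤
      72 / 11 * (a 0 + 5 * c 0) ^ 2 + (∑ s ∈ Finset.range S, w s ^ 2) / 32 := by
  set y : ℕ → ℝ := fun s => a s + 5 * c s with hy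
  have hy0 : ∀ s, 0 ≤ y s := fun s => by have := ha s; have := hc s; positivity
  have hstep : ∀ s < S, y (s + 1) ≤ 5 / 6 * y s + w s / 48 := by
    intro s hs
    have e1 := h1 s hs
    have e2 := h2 s hs
    have := ha s
    have := hc s
    simp only [hy]
    linarith
  -- `r` is the part of `y` that is driven by `w`, so that `y s ≤ (5/6)^s y 0 + r s`.
  set r : ℕ → ℝ := fun s => Nat.rec 0 (fun s r => 5 / 6 * r + w s / 48) s with hr
  have hrs : ∀ s, r (s + 1) = 5 / 6 * r s + w s / 48 := fun s => rfl
  have hyr : ∀ s ≤ S, y s ≤ (5 / 6) ^ s * y 0 + r s := by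
    intro s
    induction s with
    | zero => intro _; simp [hr]
    | succ s ih =>
      intro hs
      have e1 := hstep s hs
      have e2 := ih (Nat.le_of_succ_le hs)
      rw [hrs, pow_succ]
      linarith
  have hr2 : ∀ S, r S ^ 2 + (∑ s ∈ Finset.range S, r s ^ 2) / 6 ≤
      (∑ s ∈ Finset.range S, w s ^ 2) / 384 := by
    intro S
    induction S with
    | zero => simp [hr]
    | succ S ih =>
      rw [Finset.sum_range_succ, Finset.sum_range_succ, hrs]
      -- `5/6 r + w/48` is the convex combination of `r` and `w/8` with weights `5/6` and `1/6`.
      nlinarith [sq_nonneg (r S - w S / 8)]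
  have hsum0 : 0 ≤ ∑ s ∈ Finset.range S, r s ^ 2 := Finset.sum_nonneg fun s _ => sq_nonneg _
  refine ⟨⟨r S, ?_, by linarith [hr2 S]⟩, ?_⟩
  · have e1 := hyr S le_rfl
    have e2 : ((5 : ℝ) / 6) ^ S ≤ 5 / 6 := pow_le_of_le_one (by norm_num) (by norm_num) hS.ne'
    have e3 := mul_le_mul_of_nonneg_right e2 (hy0 0)
    have e4 : a S ≤ y S := by simp only [hy]; linarith [hc S]
    have e5 : y 0 = a 0 + 5 * c 0 := rfl
    linarith
  · have e1 : ∀ s ∈ Finset.range S, y s ^ 2 ≤ 2 * y 0 ^ 2 * (25 / 36) ^ s + 2 * r s ^ 2 := by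
      intro s hs
      have e2 := hyr s (Finset.mem_range.1 hs).le
      have e3 : ((25 : ℝ) / 36) ^ s = ((5 / 6) ^ s) ^ 2 := by
        rw [← pow_mul, mul_comm, pow_mul]; norm_num
      have e4 := pow_le_pow_left₀ (hy0 s) e2 2
      rw [e3]
      nlinarith [sq_nonneg ((5 / 6) ^ s * y 0 - r s)]
    have e2 := Finset.sum_le_sum e1
    rw [Finset.sum_add_distrib, ← Finset.mul_sum, ← Finset.mul_sum] at e2
    have e3 : ∑ s ∈ Finset.range S, ((25 : ℝ) / 36) ^ s ≤ 36 / 11 := by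
      rw [geom_sum_eq (by norm_num)]
      have : (0 : ℝ) ≤ (25 / 36) ^ S := by positivity
      rw [div_le_iff_of_neg (by norm_num)]
      linarith
    have e4 := mul_le_mul_of_nonneg_left e3 (by positivity : 0 ≤ 2 * y 0 ^ 2)
    have e5 := hr2 S
    have e6 : y 0 = a 0 + 5 * c 0 := rfl
    rw [e6] at e2 e4
    nlinarith [sq_nonneg (r S)]

/-- The consensus errors over the whole run are controlled by the steps of the average. The inner
loops need the weight `5` on `c`, the outer loops the weight `16`: mixing of the iterates has to
make up for the error they pick up from the gradient estimates. -/
lemma consensus_recursion {a c w : ℕ → ℕ → ℝ} {S T : ℕ} {σ : ℝ} (hS : 0 < S)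
    (ha : ∀ t s, 0 ≤ a t s) (hc : ∀ t s, 0 ≤ c t s)
    (hσ0 : 0 ≤ σ) (hσ : σ ≤ 2 / 3) (hσS : σ * √S ≤ 2)
    (h1 : ∀ t < T, ∀ s < S, a t (s + 1) ≤ 2 / 3 * (a t s + c t s))
    (h2 : ∀ t < T, ∀ s < S,
      c t (s + 1) ≤ 2 / 3 * (c t s + (w t s + a t (s + 1) + a t s) / 160))
    (h3 : ∀ t, t + 1 < T → a (t + 1) 0 = a t S)
    (h4 : ∀ t, t + 1 < T → c (t + 1) 0 ≤
      σ * (c t 0 + (∑ s ∈ Finset.range S, w t s + a t S + a t 0) / 160))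
    (ha0 : a 0 0 = 0) (hc0 : c 0 0 = 0) :
    ∑ t ∈ Finset.range T, ∑ s ∈ Finset.range S, (a t s + 5 * c t s) ^ 2 ≤
      400 * ∑ t ∈ Finset.range T, ∑ s ∈ Finset.range S, w t s ^ 2 := by
  set Y : ℕ → ℝ := fun t => a t 0 + 16 * c t 0 with hY
  set P : ℕ → ℝ := fun t => ∑ s ∈ Finset.range S, w t s ^ 2 with hP
  have hP0 : ∀ t, 0 ≤ P t := fun t => Finset.sum_nonneg fun s _ => sq_nonneg _
  have hY0 : ∀ t, 0 ≤ Y t := fun t => by have := ha t 0; have := hc t 0; positivity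
  have hstep : ∀ t, t + 1 < T → Y (t + 1) ^ 2 ≤ 24 / 25 * Y t ^ 2 + 9 / 4 * P t := by
    intro t ht
    have ht' : t < T := by omega
    obtain ⟨⟨R, hR1, hR2⟩, -⟩ := inner_recursion hS (ha t) (hc t) (h1 t ht') (h2 t ht')
    set Ω := √(P t) with hΩ
    have hΩ0 : 0 ≤ Ω := Real.sqrt_nonneg _
    have hΩ2 : Ω ^ 2 = P t := Real.sq_sqrt (hP0 t)
    have hR : R ≤ Ω / 19 := by
      refine le_of_sq_le_sq ?_ (by positivity)
      rw [div_pow, hΩ2]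
      refine hR2.trans ?_
      have := hP0 t
      simp only [hP] at this ⊢
      linarith
    -- Cauchy–Schwarz: the factor `√S` lost here is absorbed by `σ`.
    have hw : ∑ s ∈ Finset.range S, w t s ≤ √S * Ω := by
      refine le_of_sq_le_sq ?_ (by positivity)
      rw [mul_pow, Real.sq_sqrt (Nat.cast_nonneg S), hΩ2]
      simpa using sq_sum_le_card_mul_sum_sq (s := Finset.range S) (f := w t)
    have hσw : σ * ∑ s ∈ Finset.range S, w t s ≤ 2 * Ω := by
      calc σ * ∑ s ∈ Finset.range S, w t s ≤ σ * (√S * Ω) := by gcongr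
        _ = σ * √S * Ω := by ring
        _ ≤ 2 * Ω := by gcongr
    have e4 := h4 t ht
    have e5 := mul_le_mul_of_nonneg_right hσ (hc t 0)
    have e6 := mul_le_mul_of_nonneg_right hσ (add_nonneg (ha t S) (ha t 0))
    have e7 : Y (t + 1) ≤ 24 / 25 * Y t + 3 / 10 * Ω := by
      have := ha t 0
      have := hc t 0
      simp only [hY]
      rw [h3 t ht]
      linarith
    have e8 := pow_le_pow_left₀ (hY0 _) e7 2
    rw [← hΩ2]
    -- Convexity again, with `24/25 Y + 3/10 Ω = 24/25 Y + 1/25 (15/2 Ω)`.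
    nlinarith [sq_nonneg (Y t - 15 / 2 * Ω)]
  have hsum := sum_le_of_recursion (γ := 24 / 25) (by norm_num) (fun t => sq_nonneg (Y t))
    (fun t => by have := hP0 t; positivity) hstep
  have hY00 : Y 0 = 0 := by simp [hY, ha0, hc0]
  rw [hY00, ← Finset.mul_sum] at hsum
  have hin : ∀ t ∈ Finset.range T, ∑ s ∈ Finset.range S, (a t s + 5 * c t s) ^ 2 ≤
      72 / 11 * Y t ^ 2 + P t / 32 := by
    intro t ht
    have ht' := Finset.mem_range.1 ht
    refine (inner_recursion hS (ha t) (hc t) (h1 t ht') (h2 t ht')).2.trans ?_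
    have e1 : (a t 0 + 5 * c t 0) ^ 2 ≤ Y t ^ 2 := by
      refine pow_le_pow_left₀ ?_ ?_ 2
      · have := ha t 0; have := hc t 0; positivity
      · simp only [hY]; linarith [hc t 0]
    simp only [hP]
    linarith
  have hin2 := Finset.sum_le_sum hin
  rw [Finset.sum_add_distrib, ← Finset.mul_sum, ← Finset.sum_div] at hin2
  have : 0 ≤ ∑ t ∈ Finset.range T, P t := Finset.sum_nonneg fun t _ => hP0 t
  linarith

/-! ### Averages over independent uniform choices -/

/-- Replacing one component of a uniformly random object by a fresh uniform value does not change
averages: `(x, a) ↦ (set x a, get x)` is an involution. -/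
lemma expect_resample {X A : Type*} [Fintype X] [Fintype A] [Nonempty A] (get : X → A)
    (set : X → A → X) (get_set : ∀ x a, get (set x a) = a)
    (set_set : ∀ x a b, set (set x a) b = set x b) (set_get : ∀ x, set x (get x) = x)
    (F : X → ℝ) : 𝔼 x, F x = 𝔼 x, 𝔼 a, F (set x a) := by
  have hinv : Function.Involutive fun p : X × A => (set p.1 p.2, get p.1) := by
    rintro ⟨x, a⟩
    simp [get_set, set_set, set_get]
  calc 𝔼 x, F x = 𝔼 x, 𝔼 _a : A, F x := by simp_rw [Fintype.expect_const]
    _ = 𝔼 p : X × A, F p.1 := by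
        rw [← Finset.univ_product_univ]
        exact (Finset.expect_product' _ _ fun x (_ : A) => F x).symm
    _ = 𝔼 p : X × A, F (set p.1 p.2) :=
        (Fintype.expect_bijective (fun p : X × A => (set p.1 p.2, get p.1)) hinv.bijective
          (fun p => F (set p.1 p.2)) (fun p => F p.1) fun _ => rfl).symm
    _ = 𝔼 x, 𝔼 a, F (set x a) := by
        rw [← Finset.univ_product_univ]
        exact Finset.expect_product' _ _ fun x a => F (set x a)

section Pi

variable {P A : Type*} [Fintype P] [DecidableEq P] [Fintype A] [Nonempty A]

lemma expect_update (p : P) (F : (P → A) → ℝ) :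
    𝔼 z, F z = 𝔼 z, 𝔼 a, F (Function.update z p a) :=
  expect_resample (fun z => z p) (fun z a => Function.update z p a) (by simp) (by simp) (by simp) F

lemma expect_coord (p : P) (f : A → ℝ) : 𝔼 z : P → A, f (z p) = 𝔼 a, f a := by
  rw [expect_update p]
  simp

variable {E : Type*} [NormedAddCommGroup E] [InnerProductSpace ℝ E]

/-- The second moment of a sum of independent centred vectors and a constant. -/
lemma expect_norm_add_sum_sq (e : E) (ζ : P → A → E) (hζ : ∀ p, ∑ a, ζ p a = 0) :
    𝔼 z : P → A, ‖e + ∑ p, ζ p (z p)‖ ^ 2 = ‖e‖ ^ 2 + ∑ p, 𝔼 a, ‖ζ p a‖ ^ 2 := by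
  have hexp : ∀ z : P → A, ‖e + ∑ p, ζ p (z p)‖ ^ 2 =
      ‖e‖ ^ 2 + ∑ p, 2 * inner ℝ e (ζ p (z p)) + ∑ p, ∑ q, inner ℝ (ζ p (z p)) (ζ q (z q)) := by
    intro z
    rw [norm_add_sq_real, ← Finset.mul_sum, ← inner_sum, ← real_inner_self_eq_norm_sq (∑ p, _),
      sum_inner]
    simp_rw [inner_sum]
  have hlin : ∀ p, 𝔼 z : P → A, 2 * inner ℝ e (ζ p (z p)) = 0 := by
    intro p
    rw [expect_coord p fun a => 2 * inner ℝ e (ζ p a), Fintype.expect_eq_sum_div_card,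
      ← Finset.mul_sum, ← inner_sum, hζ]
    simp
  have hoff : ∀ p q, q ≠ p → 𝔼 z : P → A, inner ℝ (ζ p (z p)) (ζ q (z q)) = 0 := by
    intro p q hqp
    rw [expect_update q]
    refine Finset.expect_eq_zero fun z _ => ?_
    simp only [Function.update_self, Function.update_of_ne hqp.symm]
    rw [Fintype.expect_eq_sum_div_card, ← inner_sum, hζ]
    simp
  simp_rw [hexp]
  rw [Finset.expect_add_distrib, Finset.expect_add_distrib, Fintype.expect_const,
    Finset.expect_sum_comm, Finset.sum_congr rfl fun p _ => hlin p, Finset.sum_const_zero,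
    add_zero, Finset.expect_sum_comm]
  congr 1
  refine Finset.sum_congr rfl fun p _ => ?_
  rw [Finset.expect_sum_comm, Finset.sum_eq_single p (fun q _ hq => hoff p q hq) (by simp),
    expect_coord p fun a => inner ℝ (ζ p a) (ζ p a)]
  simp_rw [real_inner_self_eq_norm_sq]

lemma expect_norm_sub_average_sq_le (δ : A → E) {B : ℝ} (hB : ∀ a, ‖δ a‖ ^ 2 ≤ B) :
    𝔼 a, ‖δ a - (1 / (Fintype.card A : ℝ)) • ∑ a', δ a'‖ ^ 2 ≤ B := by
  have hcard : (0 : ℝ) < Fintype.card A := by exact_mod_cast Fintype.card_pos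
  set μ := (1 / (Fintype.card A : ℝ)) • ∑ a', δ a' with hμ
  have hsum : ∑ a, δ a = (Fintype.card A : ℝ) • μ := by
    rw [hμ, smul_smul, mul_one_div_cancel hcard.ne', one_smul]
  have h : ∀ a, ‖δ a - μ‖ ^ 2 = ‖δ a‖ ^ 2 - 2 * inner ℝ (δ a) μ + ‖μ‖ ^ 2 := fun a =>
    norm_sub_sq_real _ _
  rw [Fintype.expect_eq_sum_div_card, div_le_iff₀ hcard, Finset.sum_congr rfl fun a _ => h a,
    Finset.sum_add_distrib, Finset.sum_sub_distrib, ← Finset.mul_sum, ← sum_inner, hsum,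
    real_inner_smul_left, real_inner_self_eq_norm_sq]
  have h2 : ∑ a, ‖δ a‖ ^ 2 ≤ ∑ _a : A, B := Finset.sum_le_sum fun a _ => hB a
  simp only [Finset.sum_const, Finset.card_univ, nsmul_eq_mul] at h2 ⊢
  nlinarith [mul_nonneg hcard.le (sq_nonneg ‖μ‖)]

end Pi

/-- The error of a mini-batch average has variance smaller by the factor `n b`, as the `n b` draws
of all agents are independent. -/
lemma expect_batch_le {n m b d : ℕ} (hn : 0 < n) (hm : 0 < m) (hb : 0 < b) {L : ℝ} (e : Param d)
    (δ : Fin n → Fin m → Param d) (x : Stack n d) (hδ : ∀ i j, ‖δ i j‖ ≤ L * ‖x i‖) :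
    𝔼 z : Batch n m b, ‖e + (mean (fun i => (1 / (b : ℝ)) • ∑ k, δ i (z i k)) -
        mean (fun i => (1 / (m : ℝ)) • ∑ j, δ i j))‖ ^ 2 ≤
      ‖e‖ ^ 2 + L ^ 2 / (n * b) * (frob x ^ 2 / n) := by
  have : Nonempty (Fin m) := ⟨⟨0, hm⟩⟩
  have hn' : (0 : ℝ) < n := by exact_mod_cast hn
  have hm' : (0 : ℝ) < m := by exact_mod_cast hm
  have hb' : (0 : ℝ) < b := by exact_mod_cast hb
  set ζ : Fin n × Fin b → Fin m → Param d := fun p j =>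
    (1 / ((n : ℝ) * b)) • (δ p.1 j - (1 / (m : ℝ)) • ∑ j', δ p.1 j') with hζ
  have hζ0 : ∀ p, ∑ j, ζ p j = 0 := by
    intro p
    simp only [hζ]
    rw [← Finset.smul_sum, Finset.sum_sub_distrib, Finset.sum_const, Finset.card_univ,
      Fintype.card_fin, ← Nat.cast_smul_eq_nsmul ℝ, smul_smul, mul_one_div_cancel hm'.ne', one_smul,
      sub_self, smul_zero]
  have hval : ∀ z : Batch n m b, mean (fun i => (1 / (b : ℝ)) • ∑ k, δ i (z i k)) -
      mean (fun i => (1 / (m : ℝ)) • ∑ j, δ i j) =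
      ∑ p : Fin n × Fin b, ζ p (Function.uncurry z p) := by
    intro z
    rw [Fintype.sum_prod_type, ← map_sub, mean_apply, Finset.smul_sum]
    refine Finset.sum_congr rfl fun i _ => ?_
    simp only [hζ, Function.uncurry_apply_pair, Pi.sub_apply]
    rw [← Finset.smul_sum, Finset.sum_sub_distrib, Finset.sum_const, Finset.card_univ,
      Fintype.card_fin, ← Nat.cast_smul_eq_nsmul ℝ, smul_sub, smul_sub, smul_smul, smul_smul,
      smul_smul, smul_smul]
    congr 2 <;> field_simp
  simp_rw [hval]
  rw [Fintype.expect_equiv (Equiv.curry (Fin n) (Fin b) (Fin m)).symm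
    (fun z : Batch n m b => ‖e + ∑ p : Fin n × Fin b, ζ p (Function.uncurry z p)‖ ^ 2)
    (fun z => ‖e + ∑ p : Fin n × Fin b, ζ p (z p)‖ ^ 2) (fun _ => rfl),
    expect_norm_add_sum_sq e ζ hζ0]
  refine add_le_add le_rfl ?_
  have hterm : ∀ p : Fin n × Fin b, 𝔼 j, ‖ζ p j‖ ^ 2 ≤
      (1 / ((n : ℝ) * b)) ^ 2 * (L ^ 2 * ‖x p.1‖ ^ 2) := by
    intro p
    simp only [hζ, norm_smul, mul_pow]
    rw [← Finset.mul_expect, Real.norm_of_nonneg (by positivity)]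
    refine mul_le_mul_of_nonneg_left ?_ (by positivity)
    have h := expect_norm_sub_average_sq_le (δ p.1) (B := L ^ 2 * ‖x p.1‖ ^ 2) fun j => by
      rw [← mul_pow]
      exact pow_le_pow_left₀ (norm_nonneg _) (hδ p.1 j) 2
    simpa using h
  refine (Finset.sum_le_sum fun p _ => hterm p).trans_eq ?_
  rw [Fintype.sum_prod_type]
  simp only [Finset.sum_const, Finset.card_univ, Fintype.card_fin, nsmul_eq_mul]
  rw [frob_sq, Finset.sum_div, Finset.mul_sum]
  refine Finset.sum_congr rfl fun i _ => ?_
  field_simp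

/-! ### The objective -/

section Objective

variable {n m d : ℕ} {ℓ : Losses n m d} {L : ℝ}

/-- The gradient of the objective is the average of the local gradients. -/
lemma hasGradientAt_globalLoss (hℓ : LipschitzGradients ℓ L) (x : Param d) :
    HasGradientAt (globalLoss ℓ) (mean (localGradients ℓ fun _ => x).val) x := by
  have h1 : ∀ i j, HasFDerivAt (ℓ i j) (InnerProductSpace.toDual ℝ _ (gradient (ℓ i j) x)) x :=
    fun i j => ((hℓ i j).1 x).hasGradientAt.hasFDerivAt
  have h2 : ∀ i, HasFDerivAt (localLoss ℓ i)
      ((1 / (m : ℝ)) • ∑ j, InnerProductSpace.toDual ℝ _ (gradient (ℓ i j) x)) x := fun i =>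
    (HasFDerivAt.fun_sum fun j _ => h1 i j).const_mul _
  have h3 : HasFDerivAt (globalLoss ℓ) ((1 / (n : ℝ)) • ∑ i, (1 / (m : ℝ)) • ∑ j,
      InnerProductSpace.toDual ℝ _ (gradient (ℓ i j) x)) x :=
    (HasFDerivAt.fun_sum fun i _ => h2 i).const_mul _
  have h4 : InnerProductSpace.toDual ℝ _ (mean (localGradients ℓ fun _ => x).val) =
      (1 / (n : ℝ)) • ∑ i, (1 / (m : ℝ)) • ∑ j,
        InnerProductSpace.toDual ℝ _ (gradient (ℓ i j) x) := by
    ext y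
    simp [mean_apply, localGradients]
  rw [hasGradientAt_iff_hasFDerivAt, h4]
  exact h3

lemma gradient_globalLoss (hℓ : LipschitzGradients ℓ L) (x : Param d) :
    gradient (globalLoss ℓ) x = mean (localGradients ℓ fun _ => x).val :=
  (hasGradientAt_globalLoss hℓ x).gradient

lemma norm_localGradients_sub_le (hm : 0 < m) (hℓ : LipschitzGradients ℓ L) (x y : Stack n d)
    (i : Fin n) :
    ‖((localGradients ℓ x).val - (localGradients ℓ y).val) i‖ ≤ L * ‖(x - y) i‖ := by
  have hm' : (0 : ℝ) < m := by exact_mod_cast hm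
  simp only [localGradients, Pi.sub_apply]
  rw [← smul_sub, ← Finset.sum_sub_distrib, norm_smul, Real.norm_of_nonneg (by positivity),
    div_mul_eq_mul_div, one_mul, div_le_iff₀ hm']
  refine (norm_sum_le _ _).trans ((Finset.sum_le_sum fun j _ => (hℓ i j).2 (x i) (y i)).trans_eq ?_)
  simp
  ring

lemma frob_localGradients_sub_le (hm : 0 < m) (hL : 0 ≤ L) (hℓ : LipschitzGradients ℓ L)
    (x y : Stack n d) :
    frob ((localGradients ℓ x).val - (localGradients ℓ y).val) ≤ L * frob (x - y) :=
  frob_le_of_forall hL (norm_localGradients_sub_le hm hℓ x y)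

/-- The gradient of the objective differs from the average of local gradients at different points
by at most `L` times the distance of these points from the argument, in mean square. -/
lemma norm_gradient_sub_mean_le (hn : 0 < n) (hm : 0 < m) (hL : 0 ≤ L)
    (hℓ : LipschitzGradients ℓ L) (x : Stack n d) (z : Param d) :
    n * ‖gradient (globalLoss ℓ) z - mean (localGradients ℓ x).val‖ ^ 2 ≤
      L ^ 2 * frob ((fun _ => z) - x) ^ 2 := by
  rw [gradient_globalLoss hℓ, ← map_sub, ← mul_pow]
  exact (norm_mean_sq_le hn _).trans
    (pow_le_pow_left₀ (frob_nonneg _) (frob_localGradients_sub_le hm hL hℓ _ _) 2)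

lemma norm_gradient_globalLoss_sub_le (hn : 0 < n) (hm : 0 < m) (hL : 0 ≤ L)
    (hℓ : LipschitzGradients ℓ L) (x y : Param d) :
    ‖gradient (globalLoss ℓ) x - gradient (globalLoss ℓ) y‖ ≤ L * ‖x - y‖ := by
  have hn' : (0 : ℝ) < n := by exact_mod_cast hn
  have h := norm_gradient_sub_mean_le hn hm hL hℓ (fun _ => y) x
  rw [← gradient_globalLoss hℓ, frob_sq] at h
  simp only [Pi.sub_apply, Finset.sum_const, Finset.card_univ, Fintype.card_fin,
    nsmul_eq_mul] at h
  refine le_of_sq_le_sq ?_ (by positivity)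
  rw [mul_pow]
  nlinarith

/-- The descent inequality, with the constant `L` in place of `L/2`. -/
lemma globalLoss_le (hn : 0 < n) (hm : 0 < m) (hL : 0 ≤ L) (hℓ : LipschitzGradients ℓ L)
    (x y : Param d) :
    globalLoss ℓ y ≤ globalLoss ℓ x + inner ℝ (gradient (globalLoss ℓ) x) (y - x) +
      L * ‖y - x‖ ^ 2 := by
  have hgrad : ∀ z, HasFDerivAt (globalLoss ℓ)
      (InnerProductSpace.toDual ℝ _ (gradient (globalLoss ℓ) z)) z := fun z =>
    (hasGradientAt_globalLoss hℓ z).differentiableAt.hasGradientAt.hasFDerivAt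
  have h := (convex_segment x y).norm_image_sub_le_of_norm_hasFDerivWithin_le'
    (f := globalLoss ℓ) (C := L * ‖y - x‖)
    (φ := InnerProductSpace.toDual ℝ _ (gradient (globalLoss ℓ) x))
    (fun z _ => (hgrad z).hasFDerivWithinAt)
    (fun z hz => by
      rw [← map_sub, LinearIsometryEquiv.norm_map]
      refine (norm_gradient_globalLoss_sub_le hn hm hL hℓ z x).trans ?_
      refine mul_le_mul_of_nonneg_left ?_ hL
      rw [← dist_eq_norm, ← dist_eq_norm, dist_comm z, dist_comm y]
      have := dist_add_dist_of_mem_segment hz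
      linarith [dist_nonneg (x := z) (y := y)])
    (left_mem_segment ℝ x y) (right_mem_segment ℝ x y)
  rw [InnerProductSpace.toDual_apply_apply, Real.norm_eq_abs] at h
  have h2 := (abs_le.1 h).2
  nlinarith

end Objective

/-! ### The trajectory of the algorithm -/

section Trajectory

variable {n m d T : ℕ} (ℓ : Losses n m d) (W : Matrix (Fin n) (Fin n) ℝ) (c : Config)

lemma innerIter_congr {Z Z' : Fin c.S → Batch n m c.b} (p : Stack n d × Stack n d) (s : ℕ)
    (h : s ≤ c.S) (hZ : ∀ r : Fin c.S, (r : ℕ) < s → Z r = Z' r) :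
    innerIter ℓ W c Z p s h = innerIter ℓ W c Z' p s h := by
  induction s with
  | zero => rfl
  | succ s ih =>
    rw [innerIter, innerIter, ih _ fun r hr => hZ r (hr.trans (Nat.lt_succ_self s)),
      hZ ⟨s, h⟩ (Nat.lt_succ_self s)]

lemma outerIter_congr (x₀ : Param d) {Z Z' : Samples n m c T} (t : ℕ) (h : t ≤ T)
    (hZ : ∀ r : Fin T, (r : ℕ) < t → Z r = Z' r) :
    outerIter ℓ W c x₀ Z t h = outerIter ℓ W c x₀ Z' t h := by
  induction t with
  | zero => rfl
  | succ t ih =>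
    rw [outerIter, outerIter, ih _ fun r hr => hZ r (hr.trans (Nat.lt_succ_self t)),
      hZ ⟨t, h⟩ (Nat.lt_succ_self t)]

variable (x₀ : Param d) (Z : Samples n m c T)

/-- The pair `(u^{(t+1),s}, v^{(t+1),s})` for `t < T`, `s ≤ S`, and `0` outside this range. -/
def pairAt (t s : ℕ) : Stack n d × Stack n d :=
  if ht : t < T then
    if hs : s ≤ c.S then
      (innerIter ℓ W c (Z ⟨t, ht⟩) (track ℓ W c (outerIter ℓ W c x₀ Z t ht.le).val).val s hs).val
    else 0
  else 0

/-- The stacked iterate `u^{(t+1),s}`: outer loops are counted from `0`. -/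
def uAt (t s : ℕ) : Stack n d := (pairAt ℓ W c x₀ Z t s).1

/-- The stacked gradient estimate `v^{(t+1),s}`. -/
def vAt (t s : ℕ) : Stack n d := (pairAt ℓ W c x₀ Z t s).2

/-- The error `v̄ - (1/n) ∑_i ∇f_i(u_i)` of the average gradient estimate at step `s` of the inner
loop `t`. -/
def errAt (t s : ℕ) : Param d :=
  mean (vAt ℓ W c x₀ Z t s) - mean (localGradients ℓ (uAt ℓ W c x₀ Z t s)).val

/-- The effect of `K` accelerated mixing steps on a stacked vector. -/
def mix (K : ℕ) (y : Stack n d) : Stack n d := (chebMix (symPart W) (mixingRate W) K y).val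

variable {t s : ℕ}

lemma pairAt_of_le (ht : t < T) (hs : s ≤ c.S) :
    pairAt ℓ W c x₀ Z t s = (innerIter ℓ W c (Z ⟨t, ht⟩)
      (track ℓ W c (outerIter ℓ W c x₀ Z t ht.le).val).val s hs).val := by
  rw [pairAt, dif_pos ht, dif_pos hs]

lemma uAt_succ (ht : t < T) (hs : s < c.S) : uAt ℓ W c x₀ Z t (s + 1) =
    mix W c.Kin (uAt ℓ W c x₀ Z t s - c.η • vAt ℓ W c x₀ Z t s) := by
  rw [uAt, uAt, vAt, pairAt_of_le ℓ W c x₀ Z ht (Nat.succ_le_of_lt hs),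
    pairAt_of_le ℓ W c x₀ Z ht hs.le]
  rfl

lemma vAt_succ (ht : t < T) (hs : s < c.S) : vAt ℓ W c x₀ Z t (s + 1) =
    mix W c.Kin ((batchDifference ℓ (Z ⟨t, ht⟩ ⟨s, hs⟩) (uAt ℓ W c x₀ Z t (s + 1))
      (uAt ℓ W c x₀ Z t s)).val + vAt ℓ W c x₀ Z t s) := by
  rw [vAt, uAt, uAt, vAt, pairAt_of_le ℓ W c x₀ Z ht (Nat.succ_le_of_lt hs),
    pairAt_of_le ℓ W c x₀ Z ht hs.le]
  rfl

lemma uAt_zero_zero (hT : 0 < T) : uAt ℓ W c x₀ Z 0 0 = fun _ => x₀ := by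
  rw [uAt, pairAt_of_le ℓ W c x₀ Z hT (Nat.zero_le _)]
  rfl

lemma vAt_zero_zero (hT : 0 < T) : vAt ℓ W c x₀ Z 0 0 =
    mix W c.Kout fun _ => mean (localGradients ℓ fun _ => x₀).val := by
  rw [vAt, pairAt_of_le ℓ W c x₀ Z hT (Nat.zero_le _), mean_apply]
  refine congrArg (mix W c.Kout) ?_
  exact add_sub_cancel_right _ _

lemma uAt_succ_zero (ht : t + 1 < T) :
    uAt ℓ W c x₀ Z (t + 1) 0 = uAt ℓ W c x₀ Z t c.S := by
  rw [uAt, uAt, pairAt_of_le ℓ W c x₀ Z ht (Nat.zero_le _),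
    pairAt_of_le ℓ W c x₀ Z (Nat.lt_of_succ_lt ht) le_rfl]
  rfl

lemma vAt_succ_zero (ht : t + 1 < T) : vAt ℓ W c x₀ Z (t + 1) 0 =
    mix W c.Kout (vAt ℓ W c x₀ Z t 0 + (localGradients ℓ (uAt ℓ W c x₀ Z t c.S)).val -
      (localGradients ℓ (uAt ℓ W c x₀ Z t 0)).val) := by
  rw [vAt, vAt, uAt, uAt, pairAt_of_le ℓ W c x₀ Z ht (Nat.zero_le _),
    pairAt_of_le ℓ W c x₀ Z (Nat.lt_of_succ_lt ht) le_rfl,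
    pairAt_of_le ℓ W c x₀ Z (Nat.lt_of_succ_lt ht) (Nat.zero_le _)]
  rfl

lemma iterate_eq_uAt (t : Fin T) (s : Fin c.S) :
    iterate ℓ W c x₀ Z t s = uAt ℓ W c x₀ Z t s := by
  rw [uAt, pairAt_of_le ℓ W c x₀ Z t.isLt s.isLt.le]
  rfl

/-- The mini-batch drawn at step `s` of loop `t` is not used before that step. -/
lemma pairAt_update (ht : t < T) (hs : s < c.S) (z : Batch n m c.b) :
    pairAt ℓ W c x₀ (Function.update Z ⟨t, ht⟩ (Function.update (Z ⟨t, ht⟩) ⟨s, hs⟩ z)) t s =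
      pairAt ℓ W c x₀ Z t s := by
  rw [pairAt_of_le ℓ W c x₀ _ ht hs.le, pairAt_of_le ℓ W c x₀ _ ht hs.le, Function.update_self,
    outerIter_congr (Z' := Z) (hZ := fun r hr => Function.update_of_ne (by
      rintro rfl; exact lt_irrefl _ hr) _ _),
    innerIter_congr (Z' := Z ⟨t, ht⟩) (hZ := fun r hr => Function.update_of_ne (by
      rintro rfl; exact lt_irrefl _ hr) _ _)]

lemma innerIter_counts (Z : Fin c.S → Batch n m c.b) (p : Stack n d × Stack n d) (s : ℕ)
    (h : s ≤ c.S) : (innerIter ℓ W c Z p s h).ifo = s * (2 * c.b) ∧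
      (innerIter ℓ W c Z p s h).rounds = s * (2 * c.Kin) := by
  induction s with
  | zero => exact ⟨(Nat.zero_mul _).symm, (Nat.zero_mul _).symm⟩
  | succ s ih =>
    have e := ih (Nat.le_of_succ_le h)
    simp only [innerIter, innerStep, bind, pure, chebMix_ifo, chebMix_rounds, batchDifference, e]
    constructor <;> ring

lemma outerIter_counts (t : ℕ) (h : t ≤ T) :
    (outerIter ℓ W c x₀ Z t h).ifo = m + t * (2 * m + c.S * (2 * c.b)) ∧
      (outerIter ℓ W c x₀ Z t h).rounds = t * (c.Kout + c.S * (2 * c.Kin)) := by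
  induction t with
  | zero => simp [outerIter, initial, localGradients, bind, pure]
  | succ t ih =>
    have e := ih (Nat.le_of_succ_le h)
    simp only [outerIter, track, bind, pure, chebMix_ifo, chebMix_rounds, localGradients, e,
      innerIter_counts]
    constructor <;> ring

end Trajectory

/-! ### Convergence -/

/-- What the analysis needs from the parameters: the step size `1/(160 L)`, enough samples per
inner step to keep the variance bounded over `S` steps, and enough mixing steps. -/
structure Suitable {n : ℕ} (W : Matrix (Fin n) (Fin n) ℝ) (c : Config) (L : ℝ) : Prop where
  η_pos : 0 < c.η
  η_mul : c.η * L = 1 / 160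
  S_pos : 0 < c.S
  b_pos : 0 < c.b
  S_le : c.S ≤ n * c.b
  mix_in : mixingRate W ^ c.Kin / chebWeight (mixingRate W) c.Kin ≤ 2 / 3
  mix_out : mixingRate W ^ c.Kout / chebWeight (mixingRate W) c.Kout ≤ 2 / 3
  mix_out_sqrt : mixingRate W ^ c.Kout / chebWeight (mixingRate W) c.Kout * √c.S ≤ 2

section Convergence

variable {n m d T : ℕ} {ℓ : Losses n m d} {W : Matrix (Fin n) (Fin n) ℝ} {c : Config}
  {L : ℝ} {x₀ : Param d} {G : SimpleGraph (Fin n)} {t s : ℕ}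

lemma mean_mix (hW : IsMixingMatrix G W) (hα : mixingRate W < 1) (K : ℕ) (y : Stack n d) :
    mean (mix W K y) = mean y :=
  mean_chebMix hW hα K y

lemma frob_dev_mix_le (hn : 0 < n) (hW : IsMixingMatrix G W) (hα : mixingRate W < 1) (K : ℕ)
    (y : Stack n d) : frob (dev (mix W K y)) ≤
      mixingRate W ^ K / chebWeight (mixingRate W) K * frob (dev y) :=
  frob_dev_chebMix_le hn hW hα K y

lemma mean_const (hn : 0 < n) (x : Param d) : mean (fun _ : Fin n => x) = x := by
  have : (n : ℝ) ≠ 0 := by positivity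
  rw [mean_apply, Finset.sum_const, Finset.card_univ, Fintype.card_fin,
    ← Nat.cast_smul_eq_nsmul ℝ, smul_smul, one_div_mul_cancel this, one_smul]

lemma dev_const (hn : 0 < n) (x : Param d) : dev (fun _ : Fin n => x) = 0 := by
  ext1 i
  rw [dev_apply, mean_const hn, sub_self, Pi.zero_apply]

lemma frob_batchDifference_le {b : ℕ} (hb : 0 < b) (hL : 0 ≤ L) (hℓ : LipschitzGradients ℓ L)
    (z : Batch n m b) (x y : Stack n d) :
    frob (batchDifference ℓ z x y).val ≤ L * frob (x - y) := by
  have hb' : (0 : ℝ) < b := by exact_mod_cast hb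
  refine frob_le_of_forall hL fun i => ?_
  simp only [batchDifference, Pi.sub_apply]
  rw [norm_smul, Real.norm_of_nonneg (by positivity), div_mul_eq_mul_div, one_mul,
    div_le_iff₀ hb']
  refine (norm_sum_le _ _).trans
    ((Finset.sum_le_sum fun k _ => (hℓ i (z i k)).2 (x i) (y i)).trans_eq ?_)
  simp
  ring

variable (Z : Samples n m c T)

lemma mean_uAt_succ (hW : IsMixingMatrix G W) (hα : mixingRate W < 1) (ht : t < T)
    (hs : s < c.S) : mean (uAt ℓ W c x₀ Z t (s + 1)) =
      mean (uAt ℓ W c x₀ Z t s) - c.η • mean (vAt ℓ W c x₀ Z t s) := by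
  rw [uAt_succ ℓ W c x₀ Z ht hs, mean_mix hW hα, map_sub, map_smul]

lemma mean_uAt_eq (hW : IsMixingMatrix G W) (hα : mixingRate W < 1) (ht : t < T)
    (hs : s ≤ c.S) : mean (uAt ℓ W c x₀ Z t s) = mean (uAt ℓ W c x₀ Z t 0) -
      c.η • ∑ r ∈ Finset.range s, mean (vAt ℓ W c x₀ Z t r) := by
  induction s with
  | zero => simp
  | succ s ih =>
    rw [mean_uAt_succ Z hW hα ht hs, ih (Nat.le_of_succ_le hs), Finset.sum_range_succ, smul_add]
    abel

/-- Gradient tracking: every inner loop starts from an exact average gradient. -/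
lemma errAt_zero (hn : 0 < n) (hW : IsMixingMatrix G W) (hα : mixingRate W < 1)
    (ht : t < T) : errAt ℓ W c x₀ Z t 0 = 0 := by
  rw [errAt, sub_eq_zero]
  induction t with
  | zero =>
    rw [vAt_zero_zero ℓ W c x₀ Z ht, mean_mix hW hα, uAt_zero_zero ℓ W c x₀ Z ht, mean_const hn]
  | succ t ih =>
    rw [vAt_succ_zero ℓ W c x₀ Z ht, mean_mix hW hα, uAt_succ_zero ℓ W c x₀ Z ht, map_sub,
      map_add, ih (Nat.lt_of_succ_lt ht), add_sub_cancel_left]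

/-- The size `η √n ‖v̄‖` of the step of the stacked average. -/
def stepAt (ℓ : Losses n m d) (W : Matrix (Fin n) (Fin n) ℝ) (c : Config) (x₀ : Param d)
    (Z : Samples n m c T) (t s : ℕ) : ℝ :=
  c.η * (√n * ‖mean (vAt ℓ W c x₀ Z t s)‖)

/-- The combined consensus error of the iterates and the scaled gradient estimates. -/
def consensusAt (ℓ : Losses n m d) (W : Matrix (Fin n) (Fin n) ℝ) (c : Config) (x₀ : Param d)
    (Z : Samples n m c T) (t s : ℕ) : ℝ :=
  frob (dev (uAt ℓ W c x₀ Z t s)) + 5 * (c.η * frob (dev (vAt ℓ W c x₀ Z t s)))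

lemma stepAt_sq : stepAt ℓ W c x₀ Z t s ^ 2 =
    c.η ^ 2 * (n * ‖mean (vAt ℓ W c x₀ Z t s)‖ ^ 2) := by
  rw [stepAt, mul_pow, mul_pow, Real.sq_sqrt (Nat.cast_nonneg n)]

lemma frob_dev_uAt_succ_le (hn : 0 < n) (hW : IsMixingMatrix G W)
    (hα : mixingRate W < 1) (hc : Suitable W c L) (ht : t < T) (hs : s < c.S) :
    frob (dev (uAt ℓ W c x₀ Z t (s + 1))) ≤ 2 / 3 * (frob (dev (uAt ℓ W c x₀ Z t s)) +
      c.η * frob (dev (vAt ℓ W c x₀ Z t s))) := by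
  rw [uAt_succ ℓ W c x₀ Z ht hs]
  refine (frob_dev_mix_le hn hW hα _ _).trans
    (mul_le_mul hc.mix_in ?_ (frob_nonneg _) (by norm_num))
  rw [map_sub, map_smul]
  refine (frob_sub_le _ _).trans_eq ?_
  rw [frob_smul, abs_of_pos hc.η_pos]

lemma frob_uAt_succ_sub_sq_le (hn : 0 < n) (hW : IsMixingMatrix G W)
    (hα : mixingRate W < 1) (hc : Suitable W c L) (ht : t < T) (hs : s < c.S) :
    frob (uAt ℓ W c x₀ Z t (s + 1) - uAt ℓ W c x₀ Z t s) ^ 2 ≤ stepAt ℓ W c x₀ Z t s ^ 2 +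
      (frob (dev (uAt ℓ W c x₀ Z t (s + 1))) + frob (dev (uAt ℓ W c x₀ Z t s))) ^ 2 := by
  rw [frob_sq_eq hn, map_sub, map_sub, mean_uAt_succ Z hW hα ht hs, sub_sub_cancel_left, norm_neg,
    norm_smul, stepAt_sq, Real.norm_of_nonneg hc.η_pos.le, mul_pow]
  have := pow_le_pow_left₀ (frob_nonneg _) (frob_sub_le (dev (uAt ℓ W c x₀ Z t (s + 1)))
    (dev (uAt ℓ W c x₀ Z t s))) 2
  linarith

lemma stepAt_nonneg (hc : Suitable W c L) : 0 ≤ stepAt ℓ W c x₀ Z t s := by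
  have := hc.η_pos
  rw [stepAt]
  positivity

lemma frob_dev_vAt_succ_le (hn : 0 < n) (hL : 0 ≤ L) (hℓ : LipschitzGradients ℓ L)
    (hW : IsMixingMatrix G W) (hα : mixingRate W < 1) (hc : Suitable W c L) (ht : t < T)
    (hs : s < c.S) :
    c.η * frob (dev (vAt ℓ W c x₀ Z t (s + 1))) ≤ 2 / 3 * (c.η * frob (dev (vAt ℓ W c x₀ Z t s)) +
      (stepAt ℓ W c x₀ Z t s + frob (dev (uAt ℓ W c x₀ Z t (s + 1))) +
        frob (dev (uAt ℓ W c x₀ Z t s))) / 160) := by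
  have hη := hc.η_pos
  have h1 : frob (dev (vAt ℓ W c x₀ Z t (s + 1))) ≤ 2 / 3 * (L * frob (uAt ℓ W c x₀ Z t (s + 1) -
      uAt ℓ W c x₀ Z t s) + frob (dev (vAt ℓ W c x₀ Z t s))) := by
    rw [vAt_succ ℓ W c x₀ Z ht hs]
    refine (frob_dev_mix_le hn hW hα _ _).trans
      (mul_le_mul hc.mix_in ?_ (frob_nonneg _) (by norm_num))
    rw [map_add]
    refine (frob_add_le _ _).trans (add_le_add ((frob_dev_le hn _).trans ?_) le_rfl)
    exact frob_batchDifference_le hc.b_pos hL hℓ _ _ _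
  have h2 : frob (uAt ℓ W c x₀ Z t (s + 1) - uAt ℓ W c x₀ Z t s) ≤ stepAt ℓ W c x₀ Z t s +
      (frob (dev (uAt ℓ W c x₀ Z t (s + 1))) + frob (dev (uAt ℓ W c x₀ Z t s))) := by
    have e1 := stepAt_nonneg (ℓ := ℓ) (x₀ := x₀) Z (t := t) (s := s) hc
    have e2 := frob_nonneg (dev (uAt ℓ W c x₀ Z t (s + 1)))
    have e3 := frob_nonneg (dev (uAt ℓ W c x₀ Z t s))
    refine le_of_sq_le_sq ?_ (by positivity)
    refine (frob_uAt_succ_sub_sq_le Z hn hW hα hc ht hs).trans ?_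
    nlinarith [mul_nonneg e1 (add_nonneg e2 e3)]
  have h3 := mul_le_mul_of_nonneg_left h1 hη.le
  have h4 := mul_le_mul_of_nonneg_left h2 (by rw [hc.η_mul]; norm_num : 0 ≤ c.η * L)
  rw [hc.η_mul] at h4
  have h5 : c.η * (2 / 3 * (L * frob (uAt ℓ W c x₀ Z t (s + 1) - uAt ℓ W c x₀ Z t s) +
      frob (dev (vAt ℓ W c x₀ Z t s)))) = 2 / 3 * (1 / 160 * frob (uAt ℓ W c x₀ Z t (s + 1) -
      uAt ℓ W c x₀ Z t s)) + 2 / 3 * (c.η * frob (dev (vAt ℓ W c x₀ Z t s))) := by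
    rw [← hc.η_mul]; ring
  linarith

lemma frob_dev_vAt_succ_zero_le (hn : 0 < n) (hm : 0 < m) (hL : 0 ≤ L)
    (hℓ : LipschitzGradients ℓ L) (hW : IsMixingMatrix G W) (hα : mixingRate W < 1)
    (hc : Suitable W c L) (ht : t + 1 < T) :
    c.η * frob (dev (vAt ℓ W c x₀ Z (t + 1) 0)) ≤
      mixingRate W ^ c.Kout / chebWeight (mixingRate W) c.Kout *
        (c.η * frob (dev (vAt ℓ W c x₀ Z t 0)) +
          (∑ s ∈ Finset.range c.S, stepAt ℓ W c x₀ Z t s + frob (dev (uAt ℓ W c x₀ Z t c.S)) +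
            frob (dev (uAt ℓ W c x₀ Z t 0))) / 160) := by
  have hη := hc.η_pos
  have hσ : 0 ≤ mixingRate W ^ c.Kout / chebWeight (mixingRate W) c.Kout :=
    div_nonneg (pow_nonneg (mixingRate_nonneg W) _)
      (chebWeight_pos (mixingRate_nonneg W) hα.le _).le
  set σ := mixingRate W ^ c.Kout / chebWeight (mixingRate W) c.Kout with hσdef
  set Δu := uAt ℓ W c x₀ Z t c.S - uAt ℓ W c x₀ Z t 0 with hΔu
  have h1 : frob (dev (vAt ℓ W c x₀ Z (t + 1) 0)) ≤
      σ * (frob (dev (vAt ℓ W c x₀ Z t 0)) + L * frob Δu) := by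
    rw [vAt_succ_zero ℓ W c x₀ Z ht, add_sub_assoc]
    refine (frob_dev_mix_le hn hW hα _ _).trans (mul_le_mul_of_nonneg_left ?_ hσ)
    rw [map_add]
    exact (frob_add_le _ _).trans (add_le_add le_rfl
      ((frob_dev_le hn _).trans (frob_localGradients_sub_le hm hL hℓ _ _)))
  have h2 : frob Δu ≤ ∑ s ∈ Finset.range c.S, stepAt ℓ W c x₀ Z t s +
      frob (dev (uAt ℓ W c x₀ Z t c.S)) + frob (dev (uAt ℓ W c x₀ Z t 0)) := by
    have e1 : √n * ‖mean Δu‖ ≤ ∑ s ∈ Finset.range c.S, stepAt ℓ W c x₀ Z t s := by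
      rw [hΔu, map_sub, mean_uAt_eq Z hW hα (Nat.lt_of_succ_lt ht) le_rfl, sub_sub_cancel_left,
        norm_neg, norm_smul, Real.norm_of_nonneg hη.le]
      simp only [stepAt]
      rw [← Finset.mul_sum, ← Finset.mul_sum, mul_left_comm]
      gcongr
      exact norm_sum_le _ _
    have e2 := frob_le_add hn Δu
    have e3 := frob_sub_le (dev (uAt ℓ W c x₀ Z t c.S)) (dev (uAt ℓ W c x₀ Z t 0))
    rw [← map_sub, ← hΔu] at e3
    linarith
  calc c.η * frob (dev (vAt ℓ W c x₀ Z (t + 1) 0)) ≤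
      c.η * (σ * (frob (dev (vAt ℓ W c x₀ Z t 0)) + L * frob Δu)) := by gcongr
    _ = σ * (c.η * frob (dev (vAt ℓ W c x₀ Z t 0)) + (c.η * L) * frob Δu) := by ring
    _ ≤ _ := by
      rw [hc.η_mul]
      refine mul_le_mul_of_nonneg_left ?_ hσ
      linarith

/-- The total consensus error is bounded by the total squared step of the average, for every
choice of the mini-batches. -/
lemma sum_consensusAt_le (hn : 0 < n) (hm : 0 < m) (hL : 0 ≤ L) (hT : 0 < T)
    (hℓ : LipschitzGradients ℓ L) (hW : IsMixingMatrix G W) (hα : mixingRate W < 1)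
    (hc : Suitable W c L) :
    ∑ t ∈ Finset.range T, ∑ s ∈ Finset.range c.S, consensusAt ℓ W c x₀ Z t s ^ 2 ≤
      400 * ∑ t ∈ Finset.range T, ∑ s ∈ Finset.range c.S, stepAt ℓ W c x₀ Z t s ^ 2 := by
  refine consensus_recursion (a := fun t s => frob (dev (uAt ℓ W c x₀ Z t s)))
    (c := fun t s => c.η * frob (dev (vAt ℓ W c x₀ Z t s)))
    (σ := mixingRate W ^ c.Kout / chebWeight (mixingRate W) c.Kout)
    hc.S_pos (fun t s => frob_nonneg _) (fun t s => mul_nonneg hc.η_pos.le (frob_nonneg _))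
    (div_nonneg (pow_nonneg (mixingRate_nonneg W) _)
      (chebWeight_pos (mixingRate_nonneg W) hα.le _).le) hc.mix_out hc.mix_out_sqrt
    (fun t ht s hs => frob_dev_uAt_succ_le Z hn hW hα hc ht hs)
    (fun t ht s hs => frob_dev_vAt_succ_le Z hn hL hℓ hW hα hc ht hs)
    (fun t ht => congrArg (fun x => frob (dev x)) (uAt_succ_zero ℓ W c x₀ Z ht))
    (fun t ht => frob_dev_vAt_succ_zero_le Z hn hm hL hℓ hW hα hc ht) ?_ ?_
  · simp only [uAt_zero_zero ℓ W c x₀ Z hT, dev_const hn, frob_zero]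
  · have h := frob_dev_mix_le hn hW hα c.Kout
      (fun _ : Fin n => mean (localGradients ℓ fun _ => x₀).val)
    rw [← vAt_zero_zero ℓ W c x₀ Z hT, dev_const hn, frob_zero, mul_zero] at h
    rw [h.antisymm (frob_nonneg _), mul_zero]

lemma const_mean_sub (x : Stack n d) : (fun _ => mean x) - x = -dev x := by
  ext1 i
  rw [Pi.neg_apply, dev_apply, Pi.sub_apply, neg_sub]

/-- One step of inexact gradient descent by the average iterate. -/
lemma descent_step (hn : 0 < n) (hm : 0 < m) (hL : 0 ≤ L) (hℓ : LipschitzGradients ℓ L)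
    (hW : IsMixingMatrix G W) (hα : mixingRate W < 1) (hc : Suitable W c L) (ht : t < T)
    (hs : s < c.S) :
    ‖gradient (globalLoss ℓ) (mean (uAt ℓ W c x₀ Z t s))‖ ^ 2 +
        79 / 80 * ‖mean (vAt ℓ W c x₀ Z t s)‖ ^ 2 ≤
      2 / c.η * (globalLoss ℓ (mean (uAt ℓ W c x₀ Z t s)) -
        globalLoss ℓ (mean (uAt ℓ W c x₀ Z t (s + 1)))) +
      (2 * (L ^ 2 / n * frob (dev (uAt ℓ W c x₀ Z t s)) ^ 2) +
        2 * ‖errAt ℓ W c x₀ Z t s‖ ^ 2) := by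
  have hη := hc.η_pos
  have hn' : (0 : ℝ) < n := by exact_mod_cast hn
  rw [mean_uAt_succ Z hW hα ht hs]
  set u := uAt ℓ W c x₀ Z t s with hu
  set v := mean (vAt ℓ W c x₀ Z t s) with hv
  set g := gradient (globalLoss ℓ) (mean u) with hg
  have h1 := globalLoss_le hn hm hL hℓ (mean u) (mean u - c.η • v)
  rw [← hg, sub_sub_cancel_left, inner_neg_right, real_inner_smul_right, norm_neg, norm_smul,
    mul_pow, Real.norm_of_nonneg hη.le] at h1
  have h2 : 2 * inner ℝ g v - 1 / 80 * ‖v‖ ^ 2 ≤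
      2 / c.η * (globalLoss ℓ (mean u) - globalLoss ℓ (mean u - c.η • v)) := by
    have e : (1 : ℝ) / 80 = 2 * (c.η * L) := by rw [hc.η_mul]; norm_num
    rw [e, div_mul_eq_mul_div, le_div_iff₀ hη]
    linarith
  have h3 := norm_gradient_sub_mean_le hn hm hL hℓ u (mean u)
  rw [← hg, const_mean_sub, show frob (-dev u) = frob (dev u) from norm_neg _] at h3
  have h4 : ‖g - mean (localGradients ℓ u).val‖ ^ 2 ≤ L ^ 2 / n * frob (dev u) ^ 2 := by
    rw [div_mul_eq_mul_div, le_div_iff₀ hn']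
    linarith
  have h5 : ‖g - v‖ ^ 2 ≤ 2 * ‖g - mean (localGradients ℓ u).val‖ ^ 2 +
      2 * ‖errAt ℓ W c x₀ Z t s‖ ^ 2 := by
    have e1 : g - v = (g - mean (localGradients ℓ u).val) - errAt ℓ W c x₀ Z t s := by
      rw [errAt, ← hu, ← hv]; abel
    have e2 := parallelogram_law_with_norm ℝ (g - mean (localGradients ℓ u).val)
      (errAt ℓ W c x₀ Z t s)
    rw [e1]
    nlinarith [sq_nonneg ‖g - mean (localGradients ℓ u).val + errAt ℓ W c x₀ Z t s‖]
  have h6 := norm_sub_sq_real g v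
  linarith

lemma sum_descent (hn : 0 < n) (hm : 0 < m) (hL : 0 ≤ L) (hT : 0 < T)
    (hℓ : LipschitzGradients ℓ L) (hW : IsMixingMatrix G W) (hα : mixingRate W < 1)
    (hc : Suitable W c L) {Δ : ℝ} (hΔ : ∀ x, globalLoss ℓ x₀ - globalLoss ℓ x ≤ Δ) :
    ∑ t ∈ Finset.range T, ∑ s ∈ Finset.range c.S,
        (‖gradient (globalLoss ℓ) (mean (uAt ℓ W c x₀ Z t s))‖ ^ 2 +
          79 / 80 * ‖mean (vAt ℓ W c x₀ Z t s)‖ ^ 2) ≤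
      2 / c.η * Δ + ∑ t ∈ Finset.range T, ∑ s ∈ Finset.range c.S,
        (2 * (L ^ 2 / n * frob (dev (uAt ℓ W c x₀ Z t s)) ^ 2) +
          2 * ‖errAt ℓ W c x₀ Z t s‖ ^ 2) := by
  set φ : ℕ → ℕ → ℝ := fun t s => globalLoss ℓ (mean (uAt ℓ W c x₀ Z t s)) with hφ
  have htel : ∀ T', T' < T → ∑ t ∈ Finset.range (T' + 1), (φ t 0 - φ t c.S) =
      φ 0 0 - φ T' c.S := by
    intro T' hT'
    induction T' with
    | zero => simp
    | succ k ih =>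
      rw [Finset.sum_range_succ, ih (Nat.lt_of_succ_lt hT')]
      have : φ (k + 1) 0 = φ k c.S := by
        simp only [hφ, uAt_succ_zero ℓ W c x₀ Z hT']
      rw [this]
      ring
  have htot : ∑ t ∈ Finset.range T, (φ t 0 - φ t c.S) ≤ Δ := by
    obtain ⟨k, rfl⟩ : ∃ k, T = k + 1 := ⟨T - 1, by omega⟩
    rw [htel k (Nat.lt_succ_self k)]
    have : φ 0 0 = globalLoss ℓ x₀ := by
      simp only [hφ, uAt_zero_zero ℓ W c x₀ Z hT, mean_const hn]
    rw [this]
    exact hΔ _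
  have h1 : ∀ t ∈ Finset.range T, ∑ s ∈ Finset.range c.S,
        (‖gradient (globalLoss ℓ) (mean (uAt ℓ W c x₀ Z t s))‖ ^ 2 +
          79 / 80 * ‖mean (vAt ℓ W c x₀ Z t s)‖ ^ 2) ≤
      2 / c.η * (φ t 0 - φ t c.S) + ∑ s ∈ Finset.range c.S,
        (2 * (L ^ 2 / n * frob (dev (uAt ℓ W c x₀ Z t s)) ^ 2) +
          2 * ‖errAt ℓ W c x₀ Z t s‖ ^ 2) := by
    intro t ht
    refine (Finset.sum_le_sum fun s hs => descent_step Z hn hm hL hℓ hW hα hc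
      (Finset.mem_range.1 ht) (Finset.mem_range.1 hs)).trans_eq ?_
    rw [Finset.sum_add_distrib, ← Finset.mul_sum]
    congr 2
    exact Finset.sum_range_sub' (φ t) c.S
  refine (Finset.sum_le_sum h1).trans ?_
  rw [Finset.sum_add_distrib, ← Finset.mul_sum]
  have hη := hc.η_pos
  gcongr

/-- The squared gradients at the agents' iterates, compared with the one at the average. -/
lemma sum_norm_gradient_sq_le (hn : 0 < n) (hm : 0 < m) (hL : 0 ≤ L)
    (hℓ : LipschitzGradients ℓ L) (x : Stack n d) :
    ∑ i, ‖gradient (globalLoss ℓ) (x i)‖ ^ 2 ≤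
      n * (2 * (‖gradient (globalLoss ℓ) (mean x)‖ ^ 2 + L ^ 2 / n * frob (dev x) ^ 2)) := by
  have hn' : (0 : ℝ) < n := by exact_mod_cast hn
  have h : ∀ i, ‖gradient (globalLoss ℓ) (x i)‖ ^ 2 ≤
      2 * ‖gradient (globalLoss ℓ) (mean x)‖ ^ 2 + 2 * L ^ 2 * ‖dev x i‖ ^ 2 := by
    intro i
    have h1 := norm_gradient_globalLoss_sub_le hn hm hL hℓ (x i) (mean x)
    have h2 : ‖gradient (globalLoss ℓ) (x i)‖ ≤
        ‖gradient (globalLoss ℓ) (mean x)‖ + L * ‖dev x i‖ := by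
      rw [dev_apply]
      linarith [norm_le_norm_add_norm_sub (gradient (globalLoss ℓ) (mean x))
        (gradient (globalLoss ℓ) (x i)), norm_sub_rev (gradient (globalLoss ℓ) (mean x))
        (gradient (globalLoss ℓ) (x i))]
    have h3 := pow_le_pow_left₀ (norm_nonneg _) h2 2
    nlinarith [sq_nonneg (‖gradient (globalLoss ℓ) (mean x)‖ - L * ‖dev x i‖)]
  refine (Finset.sum_le_sum fun i _ => h i).trans_eq ?_
  rw [Finset.sum_add_distrib, ← Finset.mul_sum, ← Finset.mul_sum, ← frob_sq (dev x)]
  simp only [Finset.sum_const, Finset.card_univ, Fintype.card_fin, nsmul_eq_mul]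
  field_simp

/-- The deterministic part of the error budget: consensus errors and the increments that feed the
variance are absorbed by the squared gradient estimates, as `η L = 1/160`. -/
lemma sum_error_budget_nonpos (hn : 0 < n) (hm : 0 < m) (hL : 0 ≤ L) (hT : 0 < T)
    (hℓ : LipschitzGradients ℓ L) (hW : IsMixingMatrix G W) (hα : mixingRate W < 1)
    (hc : Suitable W c L) :
    ∑ t ∈ Finset.range T, ∑ s ∈ Finset.range c.S,
      (3 * (L ^ 2 / n * frob (dev (uAt ℓ W c x₀ Z t s)) ^ 2) +
        2 * (L ^ 2 / n * frob (uAt ℓ W c x₀ Z t (s + 1) - uAt ℓ W c x₀ Z t s) ^ 2) -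
        79 / 80 * ‖mean (vAt ℓ W c x₀ Z t s)‖ ^ 2) ≤ 0 := by
  have hη := hc.η_pos
  have hn' : (0 : ℝ) < n := by exact_mod_cast hn
  have hLpos : 0 < L := by
    refine hL.lt_of_ne' fun h => ?_
    have := hc.η_mul
    rw [h] at this
    norm_num at this
  have hterm : ∀ t ∈ Finset.range T, ∀ s ∈ Finset.range c.S,
      3 * (L ^ 2 / n * frob (dev (uAt ℓ W c x₀ Z t s)) ^ 2) +
        2 * (L ^ 2 / n * frob (uAt ℓ W c x₀ Z t (s + 1) - uAt ℓ W c x₀ Z t s) ^ 2) -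
        79 / 80 * ‖mean (vAt ℓ W c x₀ Z t s)‖ ^ 2 ≤
      L ^ 2 / n * (9 * consensusAt ℓ W c x₀ Z t s ^ 2 -
        20000 * stepAt ℓ W c x₀ Z t s ^ 2) := by
    intro t ht s hs
    have h1 := frob_uAt_succ_sub_sq_le (ℓ := ℓ) (x₀ := x₀) Z hn hW hα hc
      (Finset.mem_range.1 ht) (Finset.mem_range.1 hs)
    have h2 := frob_dev_uAt_succ_le (ℓ := ℓ) (x₀ := x₀) Z hn hW hα hc
      (Finset.mem_range.1 ht) (Finset.mem_range.1 hs)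
    have hstep : ‖mean (vAt ℓ W c x₀ Z t s)‖ ^ 2 =
        L ^ 2 / n * (25600 * stepAt ℓ W c x₀ Z t s ^ 2) := by
      have e : L = 1 / (160 * c.η) := by
        rw [eq_div_iff (by positivity)]
        linarith [hc.η_mul]
      rw [stepAt_sq, e]
      field_simp
      norm_num
    have ha := frob_nonneg (dev (uAt ℓ W c x₀ Z t s))
    have ha' := frob_nonneg (dev (uAt ℓ W c x₀ Z t (s + 1)))
    have hb := mul_nonneg hη.le (frob_nonneg (dev (vAt ℓ W c x₀ Z t s)))
    have h3 : (frob (dev (uAt ℓ W c x₀ Z t (s + 1))) + frob (dev (uAt ℓ W c x₀ Z t s))) ^ 2 ≤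
        (5 / 3 * consensusAt ℓ W c x₀ Z t s) ^ 2 := by
      refine pow_le_pow_left₀ (add_nonneg ha' ha) ?_ 2
      rw [consensusAt]
      linarith
    have h4 : frob (dev (uAt ℓ W c x₀ Z t s)) ^ 2 ≤ consensusAt ℓ W c x₀ Z t s ^ 2 := by
      refine pow_le_pow_left₀ ha ?_ 2
      rw [consensusAt]
      linarith
    have h5 : 3 * frob (dev (uAt ℓ W c x₀ Z t s)) ^ 2 +
        2 * frob (uAt ℓ W c x₀ Z t (s + 1) - uAt ℓ W c x₀ Z t s) ^ 2 -
        79 / 80 * (25600 * stepAt ℓ W c x₀ Z t s ^ 2) ≤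
        9 * consensusAt ℓ W c x₀ Z t s ^ 2 - 20000 * stepAt ℓ W c x₀ Z t s ^ 2 := by
      linarith [sq_nonneg (stepAt ℓ W c x₀ Z t s), sq_nonneg (consensusAt ℓ W c x₀ Z t s)]
    have h6 := mul_le_mul_of_nonneg_left h5 (by positivity : 0 ≤ L ^ 2 / n)
    rw [hstep]
    linarith
  refine (Finset.sum_le_sum fun t ht => Finset.sum_le_sum (hterm t ht)).trans ?_
  simp_rw [← Finset.mul_sum]
  refine mul_nonpos_of_nonneg_of_nonpos (by positivity) ?_
  simp_rw [Finset.sum_sub_distrib, ← Finset.mul_sum]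
  have h1 := sum_consensusAt_le (x₀ := x₀) Z hn hm hL hT hℓ hW hα hc
  have h2 : 0 ≤ ∑ t ∈ Finset.range T, ∑ s ∈ Finset.range c.S, stepAt ℓ W c x₀ Z t s ^ 2 :=
    Finset.sum_nonneg fun t _ => Finset.sum_nonneg fun s _ => sq_nonneg _
  linarith

lemma errAt_succ_update (hW : IsMixingMatrix G W) (hα : mixingRate W < 1) (ht : t < T)
    (hs : s < c.S) (z : Batch n m c.b) :
    errAt ℓ W c x₀ (Function.update Z ⟨t, ht⟩ (Function.update (Z ⟨t, ht⟩) ⟨s, hs⟩ z)) t (s + 1) =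
      errAt ℓ W c x₀ Z t s +
      (mean (fun i => (1 / (c.b : ℝ)) • ∑ k, (gradient (ℓ i (z i k)) (uAt ℓ W c x₀ Z t (s + 1) i) -
          gradient (ℓ i (z i k)) (uAt ℓ W c x₀ Z t s i))) -
        mean (fun i => (1 / (m : ℝ)) • ∑ j, (gradient (ℓ i j) (uAt ℓ W c x₀ Z t (s + 1) i) -
          gradient (ℓ i j) (uAt ℓ W c x₀ Z t s i)))) := by
  set Z' := Function.update Z ⟨t, ht⟩ (Function.update (Z ⟨t, ht⟩) ⟨s, hs⟩ z) with hZ'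
  have hp := pairAt_update ℓ W c x₀ Z ht hs z
  have hu : uAt ℓ W c x₀ Z' t s = uAt ℓ W c x₀ Z t s := congrArg Prod.fst hp
  have hv : vAt ℓ W c x₀ Z' t s = vAt ℓ W c x₀ Z t s := congrArg Prod.snd hp
  have hu' : uAt ℓ W c x₀ Z' t (s + 1) = uAt ℓ W c x₀ Z t (s + 1) := by
    rw [uAt_succ ℓ W c x₀ Z' ht hs, hu, hv, ← uAt_succ ℓ W c x₀ Z ht hs]
  have hz : Z' ⟨t, ht⟩ ⟨s, hs⟩ = z := by simp [hZ']
  have hloc : mean (fun i => (1 / (m : ℝ)) • ∑ j,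
      (gradient (ℓ i j) (uAt ℓ W c x₀ Z t (s + 1) i) - gradient (ℓ i j) (uAt ℓ W c x₀ Z t s i))) =
      mean (localGradients ℓ (uAt ℓ W c x₀ Z t (s + 1))).val -
        mean (localGradients ℓ (uAt ℓ W c x₀ Z t s)).val := by
    rw [← map_sub]
    congr 1
    ext1 i
    simp only [localGradients, Pi.sub_apply]
    rw [Finset.sum_sub_distrib, smul_sub]
  rw [errAt, vAt_succ ℓ W c x₀ Z' ht hs, mean_mix hW hα, hu', hu, hv, hz, map_add, hloc, errAt]
  simp only [batchDifference]
  abel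

/-- The error of the recursive gradient estimate is a martingale: each step adds an independent
centred term. -/
lemma expect_errAt_succ_le (hn : 0 < n) (hm : 0 < m) (hℓ : LipschitzGradients ℓ L)
    (hW : IsMixingMatrix G W) (hα : mixingRate W < 1) (hb : 0 < c.b) (ht : t < T)
    (hs : s < c.S) :
    𝔼 Z : Samples n m c T, ‖errAt ℓ W c x₀ Z t (s + 1)‖ ^ 2 ≤
      𝔼 Z : Samples n m c T, ‖errAt ℓ W c x₀ Z t s‖ ^ 2 + L ^ 2 / (n * c.b) *
        𝔼 Z : Samples n m c T, frob (uAt ℓ W c x₀ Z t (s + 1) - uAt ℓ W c x₀ Z t s) ^ 2 / n := by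
  have : Nonempty (Fin m) := ⟨⟨0, hm⟩⟩
  rw [expect_resample (fun Z : Samples n m c T => Z ⟨t, ht⟩ ⟨s, hs⟩)
    (fun Z z => Function.update Z ⟨t, ht⟩ (Function.update (Z ⟨t, ht⟩) ⟨s, hs⟩ z))
    (by simp) (by simp) (by simp), Finset.mul_expect, ← Finset.expect_add_distrib]
  refine Finset.expect_le_expect fun Z _ => ?_
  simp_rw [errAt_succ_update Z hW hα ht hs]
  exact expect_batch_le hn hm hb (errAt ℓ W c x₀ Z t s)
    (fun i j => gradient (ℓ i j) (uAt ℓ W c x₀ Z t (s + 1) i) -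
      gradient (ℓ i j) (uAt ℓ W c x₀ Z t s i)) _ (fun i j => (hℓ i j).2 _ _)

lemma sum_expect_errAt_le (hn : 0 < n) (hm : 0 < m) (hℓ : LipschitzGradients ℓ L)
    (hW : IsMixingMatrix G W) (hα : mixingRate W < 1) (hc : Suitable W c L) (ht : t < T) :
    ∑ s ∈ Finset.range c.S, 𝔼 Z : Samples n m c T, ‖errAt ℓ W c x₀ Z t s‖ ^ 2 ≤
      ∑ s ∈ Finset.range c.S, 𝔼 Z : Samples n m c T,
        L ^ 2 / n * frob (uAt ℓ W c x₀ Z t (s + 1) - uAt ℓ W c x₀ Z t s) ^ 2 := by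
  have hn' : (0 : ℝ) < n := by exact_mod_cast hn
  have hb' : (0 : ℝ) < c.b := by exact_mod_cast hc.b_pos
  set D : ℕ → ℝ := fun s => 𝔼 Z : Samples n m c T,
    frob (uAt ℓ W c x₀ Z t (s + 1) - uAt ℓ W c x₀ Z t s) ^ 2 / n with hD
  have hD0 : ∀ s, 0 ≤ D s := fun s => Finset.expect_nonneg fun Z _ => by positivity
  have h1 : ∀ s ≤ c.S, 𝔼 Z : Samples n m c T, ‖errAt ℓ W c x₀ Z t s‖ ^ 2 ≤
      L ^ 2 / (n * c.b) * ∑ r ∈ Finset.range s, D r := by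
    intro s
    induction s with
    | zero =>
      intro _
      simp [errAt_zero _ hn hW hα ht]
    | succ s ih =>
      intro hs
      rw [Finset.sum_range_succ, mul_add]
      exact (expect_errAt_succ_le hn hm hℓ hW hα hc.b_pos ht hs).trans
        (add_le_add (ih (Nat.le_of_succ_le hs)) le_rfl)
  have h2 : ∀ s ∈ Finset.range c.S, 𝔼 Z : Samples n m c T, ‖errAt ℓ W c x₀ Z t s‖ ^ 2 ≤
      L ^ 2 / (n * c.b) * ∑ r ∈ Finset.range c.S, D r := by
    intro s hs
    have hs' := Finset.mem_range.1 hs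
    refine (h1 s hs'.le).trans (mul_le_mul_of_nonneg_left ?_ (by positivity))
    exact Finset.sum_le_sum_of_subset_of_nonneg (Finset.range_mono hs'.le) fun r _ _ => hD0 r
  refine (Finset.sum_le_sum h2).trans ?_
  have hS : (c.S : ℝ) ≤ n * c.b := by exact_mod_cast hc.S_le
  have hsum : 0 ≤ ∑ r ∈ Finset.range c.S, D r := Finset.sum_nonneg fun r _ => hD0 r
  rw [Finset.sum_const, Finset.card_range, nsmul_eq_mul]
  calc (c.S : ℝ) * (L ^ 2 / (n * c.b) * ∑ r ∈ Finset.range c.S, D r) ≤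
      (n * c.b) * (L ^ 2 / (n * c.b) * ∑ r ∈ Finset.range c.S, D r) := by gcongr
    _ = L ^ 2 * ∑ r ∈ Finset.range c.S, D r := by field_simp
    _ = _ := by
      rw [Finset.mul_sum]
      refine Finset.sum_congr rfl fun r _ => ?_
      simp only [hD]
      rw [Finset.mul_expect]
      refine Finset.expect_congr rfl fun Z _ => ?_
      ring

/-- The mean squared gradient at the output point. -/
lemma expect_norm_gradient_destress_le (hn : 0 < n) (hm : 0 < m) (hL : 0 ≤ L) (hT : 0 < T)
    (hℓ : LipschitzGradients ℓ L) (hW : IsMixingMatrix G W) (hα : mixingRate W < 1)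
    (hc : Suitable W c L) {Δ : ℝ} (hΔ : ∀ x, globalLoss ℓ x₀ - globalLoss ℓ x ≤ Δ) :
    𝔼 ω : Outcome n m c T, ‖gradient (globalLoss ℓ) (destress ℓ W c x₀ T ω).val‖ ^ 2 ≤
      4 * Δ / (c.η * (T * c.S)) := by
  have : Nonempty (Fin m) := ⟨⟨0, hm⟩⟩
  have hn' : (0 : ℝ) < n := by exact_mod_cast hn
  have hT' : (0 : ℝ) < T := by exact_mod_cast hT
  have hS' : (0 : ℝ) < c.S := by exact_mod_cast hc.S_pos
  have hη := hc.η_pos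
  set R : Samples n m c T → ℝ := fun Z => ∑ t ∈ Finset.range T, ∑ s ∈ Finset.range c.S,
    (3 * (L ^ 2 / n * frob (dev (uAt ℓ W c x₀ Z t s)) ^ 2) +
      2 * ‖errAt ℓ W c x₀ Z t s‖ ^ 2 - 79 / 80 * ‖mean (vAt ℓ W c x₀ Z t s)‖ ^ 2) with hR
  have hpath : ∀ Z : Samples n m c T, 𝔼 p : Fin T × Fin c.S × Fin n,
      ‖gradient (globalLoss ℓ) (iterate ℓ W c x₀ Z p.1 p.2.1 p.2.2)‖ ^ 2 ≤
      2 / (T * c.S) * (2 / c.η * Δ + R Z) := by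
    intro Z
    rw [Fintype.expect_eq_sum_div_card, Fintype.sum_prod_type]
    simp_rw [Fintype.sum_prod_type, iterate_eq_uAt]
    have h1 : ∑ t : Fin T, ∑ s : Fin c.S, ∑ i,
        ‖gradient (globalLoss ℓ) (uAt ℓ W c x₀ Z t s i)‖ ^ 2 =
        ∑ t ∈ Finset.range T, ∑ s ∈ Finset.range c.S, ∑ i,
          ‖gradient (globalLoss ℓ) (uAt ℓ W c x₀ Z t s i)‖ ^ 2 := by
      rw [Finset.sum_range]
      exact Finset.sum_congr rfl fun t _ => (Finset.sum_range fun s => ∑ i,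
        ‖gradient (globalLoss ℓ) (uAt ℓ W c x₀ Z t s i)‖ ^ 2).symm
    have h2 := Finset.sum_le_sum (s := Finset.range T) fun t _ =>
      Finset.sum_le_sum (s := Finset.range c.S) fun s _ =>
        sum_norm_gradient_sq_le hn hm hL hℓ (uAt ℓ W c x₀ Z t s)
    have h3 := sum_descent Z hn hm hL hT hℓ hW hα hc hΔ
    have h4 : ∑ t ∈ Finset.range T, ∑ s ∈ Finset.range c.S,
        (‖gradient (globalLoss ℓ) (mean (uAt ℓ W c x₀ Z t s))‖ ^ 2 +
          L ^ 2 / n * frob (dev (uAt ℓ W c x₀ Z t s)) ^ 2) ≤ 2 / c.η * Δ + R Z := by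
      simp only [hR, Finset.sum_add_distrib, Finset.sum_sub_distrib, ← Finset.mul_sum] at h3 ⊢
      linarith
    simp_rw [← Finset.mul_sum] at h2
    rw [h1, div_le_iff₀ (by simp; positivity)]
    refine h2.trans ?_
    simp only [Fintype.card_prod, Fintype.card_fin]
    push_cast
    calc _ ≤ (n : ℝ) * (2 * (2 / c.η * Δ + R Z)) := by gcongr
      _ = _ := by field_simp
  have hexpR : 𝔼 Z, R Z ≤ 0 := by
    have h1 := fun Z : Samples n m c T =>
      sum_error_budget_nonpos (x₀ := x₀) Z hn hm hL hT hℓ hW hα hc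
    have h2 := Finset.expect_le_expect (s := Finset.univ) fun Z _ => h1 Z
    rw [Finset.expect_const_zero] at h2
    refine le_trans ?_ h2
    rw [Finset.expect_sum_comm, Finset.expect_sum_comm]
    refine Finset.sum_le_sum fun t ht => ?_
    rw [Finset.expect_sum_comm, Finset.expect_sum_comm]
    have h3 := sum_expect_errAt_le (x₀ := x₀) hn hm hℓ hW hα hc (Finset.mem_range.1 ht)
    simp only [Finset.expect_sub_distrib, Finset.expect_add_distrib, Finset.sum_sub_distrib,
      Finset.sum_add_distrib]
    simp only [← Finset.mul_expect, ← Finset.mul_sum] at h3 ⊢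
    linarith
  calc 𝔼 ω : Outcome n m c T, ‖gradient (globalLoss ℓ) (destress ℓ W c x₀ T ω).val‖ ^ 2 =
      𝔼 Z : Samples n m c T, 𝔼 p : Fin T × Fin c.S × Fin n,
        ‖gradient (globalLoss ℓ) (iterate ℓ W c x₀ Z p.1 p.2.1 p.2.2)‖ ^ 2 := by
        rw [← Finset.univ_product_univ]
        exact Finset.expect_product' _ _ fun (Z : Samples n m c T) (p : Fin T × Fin c.S × Fin n) =>
          ‖gradient (globalLoss ℓ) (iterate ℓ W c x₀ Z p.1 p.2.1 p.2.2)‖ ^ 2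
    _ ≤ 𝔼 Z : Samples n m c T, 2 / (T * c.S) * (2 / c.η * Δ + R Z) :=
        Finset.expect_le_expect fun Z _ => hpath Z
    _ = 2 / (T * c.S) * (2 / c.η * Δ + 𝔼 Z, R Z) := by
        rw [← Finset.mul_expect, Finset.expect_add_distrib, Fintype.expect_const]
    _ ≤ 2 / (T * c.S) * (2 / c.η * Δ + 0) := by gcongr
    _ = 4 * Δ / (c.η * (T * c.S)) := by
        field_simp
        ring

end Convergence

/-! ### The parameter choices -/

section Parameters

variable {n m : ℕ}

lemma one_le_sqrt_mul (hn : 0 < n) (hm : 0 < m) : 1 ≤ √((m : ℝ) * n) := by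
  have hn' : (1 : ℝ) ≤ n := by exact_mod_cast hn
  have hm' : (1 : ℝ) ≤ m := by exact_mod_cast hm
  exact Real.one_le_sqrt.2 (one_le_mul_of_one_le_of_one_le hm' hn')

lemma natCast_mul_sqrt_div (hn : 0 < n) : (n : ℝ) * √((m : ℝ) / n) = √((m : ℝ) * n) := by
  have hn' : (0 : ℝ) < n := by exact_mod_cast hn
  have h : (m : ℝ) * n = (n : ℝ) ^ 2 * (m / n) := by field_simp
  rw [h, Real.sqrt_mul (by positivity), Real.sqrt_sq hn'.le]

lemma chosenConfig_S_pos (hn : 0 < n) (hm : 0 < m) (L α : ℝ) : 0 < (chosenConfig n m L α).S :=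
  Nat.ceil_pos.2 (zero_lt_one.trans_le (one_le_sqrt_mul hn hm))

lemma le_chosenConfig_S (L α : ℝ) : √((m : ℝ) * n) ≤ (chosenConfig n m L α).S := Nat.le_ceil _

lemma chosenConfig_S_le (hn : 0 < n) (hm : 0 < m) (L α : ℝ) :
    ((chosenConfig n m L α).S : ℝ) ≤ 2 * √((m : ℝ) * n) := by
  have h : ((chosenConfig n m L α).S : ℝ) < √((m : ℝ) * n) + 1 :=
    Nat.ceil_lt_add_one (by positivity)
  linarith [one_le_sqrt_mul hn hm]

lemma chosenConfig_b_pos (hn : 0 < n) (hm : 0 < m) (L α : ℝ) : 0 < (chosenConfig n m L α).b := by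
  have hn' : (0 : ℝ) < n := by exact_mod_cast hn
  have hm' : (0 : ℝ) < m := by exact_mod_cast hm
  exact Nat.ceil_pos.2 (by positivity)

lemma chosenConfig_b_le (L α : ℝ) : ((chosenConfig n m L α).b : ℝ) ≤ √((m : ℝ) / n) + 1 :=
  (Nat.ceil_lt_add_one (Real.sqrt_nonneg _)).le

lemma suitable_chosenConfig (hn : 0 < n) (hm : 0 < m) {L : ℝ} (hL : 0 < L)
    {W : Matrix (Fin n) (Fin n) ℝ} (hα : mixingRate W < 1) :
    Suitable W (chosenConfig n m L (mixingRate W)) L := by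
  have hb := chosenConfig_b_pos hn hm L (mixingRate W)
  have hS : (chosenConfig n m L (mixingRate W)).S ≤ n * (chosenConfig n m L (mixingRate W)).b := by
    refine Nat.ceil_le.2 ?_
    rw [← natCast_mul_sqrt_div hn]
    push_cast
    exact mul_le_mul_of_nonneg_left (Nat.le_ceil _) (Nat.cast_nonneg n)
  have hnb : (1 : ℝ) ≤ n * ((chosenConfig n m L (mixingRate W)).b : ℝ) := by
    exact_mod_cast Nat.mul_pos hn hb
  have hq : 2 ≤ √(n * ((chosenConfig n m L (mixingRate W)).b : ℝ)) + 1 := by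
    linarith [Real.one_le_sqrt.2 hnb]
  have hα0 := mixingRate_nonneg W
  have hout := pow_div_chebWeight_le hα0 hα hq
    (k := (chosenConfig n m L (mixingRate W)).Kout) (Nat.le_ceil _)
  refine ⟨by simp only [chosenConfig]; positivity, by simp only [chosenConfig]; field_simp,
    chosenConfig_S_pos hn hm _ _, hb, hS,
    (pow_div_chebWeight_le hα0 hα le_rfl (Nat.le_ceil _)).1, hout.1, le_trans ?_ hout.2⟩
  refine mul_le_mul_of_nonneg_left ?_ (div_nonneg (pow_nonneg hα0 _)
      (chebWeight_pos hα0 hα.le _).le)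
  have h : √((chosenConfig n m L (mixingRate W)).S : ℝ) ≤
      √(n * ((chosenConfig n m L (mixingRate W)).b : ℝ)) :=
    Real.sqrt_le_sqrt (by exact_mod_cast hS)
  linarith

/-- Gradient evaluations in one outer loop; `S b` is of order `m + √(mn)`, and
`√(mn) = √(n/m) m`. -/
lemma loop_ifo_le (hn : 0 < n) (hm : 0 < m) (L α : ℝ) :
    2 * (m : ℝ) + (chosenConfig n m L α).S * (2 * (chosenConfig n m L α).b) ≤
      10 * max 1 √((n : ℝ) / m) * m := by
  have h1 := chosenConfig_S_le hn hm L α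
  have h2 := chosenConfig_b_le (n := n) (m := m) L α
  have hA : √((m : ℝ) * n) * √((m : ℝ) / n) = m := by
    have hn' : (0 : ℝ) < n := by exact_mod_cast hn
    have hm' : (0 : ℝ) < m := by exact_mod_cast hm
    rw [← Real.sqrt_mul (by positivity), show (m : ℝ) * n * (m / n) = m ^ 2 by field_simp,
      Real.sqrt_sq hm'.le]
  have h3 : √((m : ℝ) * n) = √((n : ℝ) / m) * m := by
    rw [mul_comm (m : ℝ) n, ← natCast_mul_sqrt_div hm, mul_comm]
  have hM1 : (m : ℝ) ≤ max 1 √((n : ℝ) / m) * m :=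
    le_mul_of_one_le_left (Nat.cast_nonneg m) (le_max_left _ _)
  have hM2 : √((m : ℝ) * n) ≤ max 1 √((n : ℝ) / m) * m := by
    rw [h3]
    exact mul_le_mul_of_nonneg_right (le_max_right _ _) (Nat.cast_nonneg m)
  have h4 := mul_le_mul h1 h2 (Nat.cast_nonneg _) (by positivity)
  linarith

/-- Communication rounds in one outer loop. The outer mixing costs no more than the order of
the `2 S` inner mixings, since `log (√(nb) + 1) ≤ √(nb) ≤ 2 √(mn)`. -/
lemma loop_rounds_le (hn : 0 < n) (hm : 0 < m) (L : ℝ) {α : ℝ} (h0 : 0 ≤ α) (h1 : α < 1) :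
    ((chosenConfig n m L α).Kout : ℝ) +
        (chosenConfig n m L α).S * (2 * (chosenConfig n m L α).Kin) ≤
      1 / √(1 - α) * (7 * (chosenConfig n m L α).S) := by
  have hg : 0 < √(1 - α) := Real.sqrt_pos.2 (by linarith)
  have hg1 : 1 ≤ 1 / √(1 - α) := by
    rw [le_div_iff₀ hg, one_mul]
    exact Real.sqrt_le_one.2 (by linarith)
  have hA1 := one_le_sqrt_mul hn hm
  have hAS := le_chosenConfig_S (n := n) (m := m) L α
  have hin : ((chosenConfig n m L α).Kin : ℝ) ≤ 1 / √(1 - α) * 2 := by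
    have h : ((chosenConfig n m L α).Kin : ℝ) < Real.log 2 / √(1 - α) + 1 :=
      Nat.ceil_lt_add_one (div_nonneg (Real.log_nonneg (by norm_num)) hg.le)
    have hl : Real.log 2 / √(1 - α) ≤ 1 / √(1 - α) := by
      gcongr
      linarith [Real.log_two_lt_d9]
    linarith
  have hnb : √((n : ℝ) * (chosenConfig n m L α).b) ≤ 2 * √((m : ℝ) * n) := by
    have hn' : (0 : ℝ) < n := by exact_mod_cast hn
    have hm' : (1 : ℝ) ≤ m := by exact_mod_cast hm
    have hsq : √((m : ℝ) * n) ^ 2 = m * n := Real.sq_sqrt (by positivity)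
    rw [Real.sqrt_le_left (by positivity), mul_pow]
    have h2 := mul_le_mul_of_nonneg_left (chosenConfig_b_le (n := n) (m := m) L α) hn'.le
    rw [mul_add, natCast_mul_sqrt_div hn] at h2
    nlinarith
  have hout : ((chosenConfig n m L α).Kout : ℝ) ≤
      1 / √(1 - α) * (3 * (chosenConfig n m L α).S) := by
    have hpos : 0 ≤ √((n : ℝ) * (chosenConfig n m L α).b) := Real.sqrt_nonneg _
    have hlog : Real.log (√((n : ℝ) * (chosenConfig n m L α).b) + 1) ≤
        2 * (chosenConfig n m L α).S := by
      linarith [Real.log_le_sub_one_of_pos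
        (by linarith : 0 < √((n : ℝ) * (chosenConfig n m L α).b) + 1)]
    have h : ((chosenConfig n m L α).Kout : ℝ) <
        Real.log (√((n : ℝ) * (chosenConfig n m L α).b) + 1) / √(1 - α) + 1 :=
      Nat.ceil_lt_add_one (div_nonneg
        (Real.log_nonneg (le_add_of_nonneg_left (Real.sqrt_nonneg _))) hg.le)
    have h2 : Real.log (√((n : ℝ) * (chosenConfig n m L α).b) + 1) / √(1 - α) ≤
        1 / √(1 - α) * (2 * (chosenConfig n m L α).S) := by
      rw [div_mul_eq_mul_div, one_mul]
      gcongr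
    have h3 : 1 ≤ 1 / √(1 - α) * (chosenConfig n m L α).S :=
      one_le_mul_of_one_le_of_one_le hg1 (hA1.trans hAS)
    linarith
  have h5 := mul_le_mul_of_nonneg_left hin
    (by positivity : (0 : ℝ) ≤ 2 * (chosenConfig n m L α).S)
  linarith

end Parameters

end Destress

end

theorem corollary1 :
    ∃ C : ℝ, 0 < C ∧
      ∀ (n m : ℕ), 0 < n → 0 < m →
      ∀ (L ε Δ : ℝ), 0 < L → 0 < ε → 0 ≤ Δ →
      ∃ T : ℕ, 0 < T ∧
        ∀ (d : ℕ) (G : SimpleGraph (Fin n)) (W : Matrix (Fin n) (Fin n) ℝ),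
          Destress.IsMixingMatrix G W → Destress.mixingRate W < 1 →
        ∀ (ℓ : Destress.Losses n m d) (x₀ : Destress.Param d),
          Destress.LipschitzGradients ℓ L →
          BddBelow (Set.range (Destress.globalLoss ℓ)) →
          Destress.globalLoss ℓ x₀ - (⨅ x, Destress.globalLoss ℓ x) ≤ Δ →
          let α := Destress.mixingRate W
          let c := Destress.chosenConfig n m L α
          (𝔼 ω : Destress.Outcome n m c T,
              ‖gradient (Destress.globalLoss ℓ) (Destress.destress ℓ W c x₀ T ω).val‖ ^ 2) ≤ ε ∧
          ∀ ω : Destress.Outcome n m c T,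
            ((Destress.destress ℓ W c x₀ T ω).ifo : ℝ) ≤
                C * max 1 √((n : ℝ) / m) * (m + √((m : ℝ) / n) * (L * Δ / ε)) ∧
            ((Destress.destress ℓ W c x₀ T ω).rounds : ℝ) ≤
                C * (1 / √(1 - α) * (√((m : ℝ) * n) + L * Δ / ε)) := by
  refine ⟨10000, by norm_num, fun n m hn hm L ε Δ hL hε hΔ => ?_⟩
  have hn' : (0 : ℝ) < n := by exact_mod_cast hn
  have hm' : (0 : ℝ) < m := by exact_mod_cast hm
  set A := √((m : ℝ) * n) with hA
  have hA1 : 1 ≤ A := Destress.one_le_sqrt_mul hn hm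
  set X := L * Δ / ε with hX
  have hX0 : 0 ≤ X := by positivity
  -- After `T` outer loops the mean squared gradient is at most `640 L Δ / (T S)`, and `S ≥ A`; the
  -- summand `1` keeps `T` positive when `Δ = 0`.
  refine ⟨⌈640 * X / A⌉₊ + 1, Nat.succ_pos _, fun d G W hW hα ℓ x₀ hℓ hbdd hx₀ => ?_⟩
  intro α c
  set T := ⌈640 * X / A⌉₊ + 1 with hTdef
  have hT1 : 640 * X / A ≤ T := (Nat.le_ceil _).trans (by simp [hTdef])
  have hT2 : (T : ℝ) ≤ 640 * X / A + 2 := by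
    have h : (⌈640 * X / A⌉₊ : ℝ) < 640 * X / A + 1 := Nat.ceil_lt_add_one (by positivity)
    rw [hTdef]
    push_cast
    linarith
  have hT0 : (0 : ℝ) < T := by rw [hTdef]; positivity
  have hα0 : 0 ≤ α := Destress.mixingRate_nonneg W
  have hAS : A ≤ c.S := Destress.le_chosenConfig_S L α
  have hSA : (c.S : ℝ) ≤ 2 * A := Destress.chosenConfig_S_le hn hm L α
  have hS0 : (0 : ℝ) < c.S := by linarith
  have hg : 0 < √(1 - α) := Real.sqrt_pos.2 (sub_pos.2 hα)
  refine ⟨?_, fun ω => ⟨?_, ?_⟩⟩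
  · have h := Destress.expect_norm_gradient_destress_le (T := T) hn hm hL.le (Nat.succ_pos _) hℓ hW
      hα (Destress.suitable_chosenConfig hn hm hL hα)
      (fun x => (sub_le_sub_left (ciInf_le hbdd x) _).trans hx₀)
    refine h.trans ?_
    have hη : c.η = 1 / (160 * L) := rfl
    rw [div_le_iff₀ (by rw [hη]; positivity), hη]
    have h1 : 640 * X ≤ T * c.S := by
      rw [div_le_iff₀ (by linarith)] at hT1
      exact hT1.trans (by gcongr)
    have h2 : 4 * Δ = ε * (1 / (160 * L) * (640 * X)) := by rw [hX]; field_simp; ring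
    rw [h2]
    gcongr
  · have h := (Destress.outerIter_counts ℓ W c x₀ ω.1 T le_rfl).1
    rw [show (Destress.destress ℓ W c x₀ T ω).ifo =
      (Destress.outerIter ℓ W c x₀ ω.1 T le_rfl).ifo from rfl, h]
    push_cast
    set M := max 1 √((n : ℝ) / m) with hM
    have hM1 : 1 ≤ M := le_max_left _ _
    have hr : √((m : ℝ) / n) = m / A := by
      rw [hA, Real.sqrt_div' _ hn'.le, Real.sqrt_mul hm'.le, div_eq_div_iff (by positivity)
        (by positivity), ← mul_assoc, Real.mul_self_sqrt hm'.le]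
    calc (m : ℝ) + T * (2 * m + c.S * (2 * c.b)) ≤
        M * m + (640 * X / A + 2) * (10 * M * m) := by
          gcongr
          · exact le_mul_of_one_le_left hm'.le hM1
          · exact Destress.loop_ifo_le hn hm L α
      _ = 21 * (M * m) + 6400 * M * (m / A * X) := by ring
      _ ≤ 10000 * (M * m) + 10000 * M * (m / A * X) := by
          gcongr <;> norm_num
      _ = 10000 * M * (m + √((m : ℝ) / n) * X) := by rw [hr]; ring
  · have h := (Destress.outerIter_counts ℓ W c x₀ ω.1 T le_rfl).2
    rw [show (Destress.destress ℓ W c x₀ T ω).rounds =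
      (Destress.outerIter ℓ W c x₀ ω.1 T le_rfl).rounds from rfl, h]
    push_cast
    have hTS : (T : ℝ) * c.S ≤ 1280 * (A + X) := by
      calc (T : ℝ) * c.S ≤ (640 * X / A + 2) * (2 * A) := by gcongr
        _ = 1280 * X + 4 * A := by field_simp; ring
        _ ≤ 1280 * (A + X) := by linarith
    calc (T : ℝ) * (c.Kout + c.S * (2 * c.Kin)) ≤ T * (1 / √(1 - α) * (7 * c.S)) := by
          gcongr
          exact Destress.loop_rounds_le hn hm L hα0 hα
      _ = 7 * (1 / √(1 - α)) * (T * c.S) := by ring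
      _ ≤ 7 * (1 / √(1 - α)) * (1280 * (A + X)) := by gcongr
      _ ≤ 10000 * (1 / √(1 - α) * (A + X)) := by
          have : 0 ≤ 1 / √(1 - α) * (A + X) := by positivity
          linarith
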